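/- \textbf{Setting.} Let $\Gamma$ be the set of links of a river network, i.e. of a finite rooted binary tree: there is a root link $r$, every other link drains into exactly one link, following the flow from any link leads to $r$, and every link has at most two tributaries. To each link $e$ belong a hillslope area $a_e>0$ and inverse residence times $K_e>0$ (stream) and $H_e>0$ (hillslope). Put $a=\sum_{e}a_e$, $\mathbf K=\operatorname{diag}(K_e)$, $\mathbf H=\operatorname{diag}(H_e)$, let $\boldsymbol\Lambda$ be the matrix with $\boldsymbol\Lambda_{e,e}=1$, $\boldsymbol\Lambda_{e,f}=-1$ if $f$ is a tributary of $e$, and all other entries $0$, and let $$\mathbf M=\begin{pmatrix}-\mathbf K\boldsymbol\Lambda&\mathbf K\\ \mathbf 0&-\mathbf H\end{pmatrix}.$$ Rainfall is spatially uniform: the storm times $0<T_1<T_2<\cdots$ are those of a Poisson process $N$ of intensity $\lambda>0$, and the storm depths $P_1,P_2,\dots$ are positive i.i.d. random variables independent of the storm times. Streamflow $Q_e$ and runoff $R_e$, $e\in\Gamma$, form the process $\boldsymbol X=(\boldsymbol Q,\boldsymbol R)$ on $(0,\infty)^{2|\Gamma|}$ that solves $$d\boldsymbol X(t)=\mathbf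 M\boldsymbol X(t)\,dt+d\boldsymbol Y(t),\qquad \boldsymbol Y(t)=\sum_{m=1}^{N(t)}\begin{pmatrix}\mathbf 0\\ (H_ea_eP_m)_{e\in\Gamma}\end{pmatrix}.$$ An invariant distribution of $\boldsymbol X$ is a probability measure $g$ on $(0,\infty)^{2|\Gamma|}$ with $\int \mathbb P_{\boldsymbol x}(\boldsymbol X(t)\in A)\,g(d\boldsymbol x)=g(A)$ for all $t>0$ and all measurable $A\subseteq(0,\infty)^{2|\Gamma|}$. For $u\in(0,1)$ let $\boldsymbol m_r(u)\in\mathbb R^{\Gamma}$ be the second half (the entries with row index $R_e$, $e\in\Gamma$) of the column of $u^{-\mathbf M^{\top}/H_r}:=\exp\!\big(-\tfrac{\log u}{H_r}\mathbf M^{\top}\big)$ that corresponds to $Q_r$, and for $\alpha>0$ put $$c_\alpha=\int_0^1\frac{1}{u}\Big[\sum_{e\in\Gamma}\frac{H_e}{K_r}\,\frac{a_e}{a}\,m_{r,e}(u)\Big]^{\alpha}du .$$ For $1\le k\le n$ let $$B_{n,k}(x_1,\dots,x_{n-k+1})=n!\sum_{j}\ \prod_{i=1}^{n-k+1}\frac1{j_i!}\Big(\frac{x_i}{i!}\Big)^{j_i}$$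 be the partial exponential Bell polynomial, where the sum is over all $j=(j_1,\dots,j_{n-k+1})$ of non-negative integers with $\sum_i j_i=k$ and $\sum_i i\,j_i=n$. \textbf{Proposition.} Let $g$ be an invariant distribution of $\boldsymbol X$ and let $n\ge1$. The integrals $c_\alpha$, $\alpha>0$, converge. The $n$-th moment $\mathbb E_g Q_r^n$ is finite if and only if the $n$-th moment of $P_1$ is finite, and in that case $$\mathbb E_g Q_r^n=(aK_r)^n\sum_{k=1}^n\Big(\frac{\lambda}{H_r}\Big)^k B_{n,k}\Big(\big\{\mu_P^{(i)}c_i\big\}_{i=1}^{n-k+1}\Big),\qquad \mu_P^{(i)}=\mathbb E P_1^i .$$ -/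

import Mathlib

open MeasureTheory ProbabilityTheory

/-- A river network: a finite rooted binary tree, described by its set `Γ` of links.  Every link
except the root drains into exactly one link, `down e`; following the flow from any link leads to
the root; and no link has more than two tributaries. -/
structure RiverNetwork (Γ : Type*) [Fintype Γ] [DecidableEq Γ] where
  /-- the most downstream link -/
  root : Γ
  /-- the link into which a link drains -/
  down : Γ → Option Γ
  down_root : down root = none
  reaches_root : ∀ e, Relation.ReflTransGen (fun e f => down e = some f) e root
  binary : ∀ e, (Finset.univ.filter (fun f => down f = some e)).card ≤ 2

/-- A watershed: a river network with the hillslope areas `a e` and the inverse residence times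
`K e` (streams) and `H e` (hillslopes) of its links. -/
structure Watershed (Γ : Type*) [Fintype Γ] [DecidableEq Γ] extends RiverNetwork Γ where
  a : Γ → ℝ
  K : Γ → ℝ
  H : Γ → ℝ
  a_pos : ∀ e, 0 < a e
  K_pos : ∀ e, 0 < K e
  H_pos : ∀ e, 0 < H e

/-- Vectors `x = (x₁, x₂)`: the coordinate `Sum.inl e` is the streamflow `Q_e`, the coordinate
`Sum.inr e` is the runoff `R_e`. -/
abbrev FlowState (Γ : Type*) : Type _ := Γ ⊕ Γ → ℝ

/-- The open positive orthant, the state space of the process. -/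
def positiveOrthant (Γ : Type*) : Set (FlowState Γ) := {x | ∀ i, 0 < x i}

/-- The incidence matrix of the network. -/
def RiverNetwork.incidence {Γ : Type*} [Fintype Γ] [DecidableEq Γ] (N : RiverNetwork Γ) :
    Matrix Γ Γ ℝ :=
  Matrix.of fun e f => if e = f then 1 else if N.down f = some e then -1 else 0

namespace Watershed

variable {Γ : Type*} [Fintype Γ] [DecidableEq Γ]

/-- The total area of the watershed. -/
def totalArea (W : Watershed Γ) : ℝ := ∑ e, W.a e

/-- The block matrix `[[-K Λ, K], [0, -H]]` that drives the system. -/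
def driftMatrix (W : Watershed Γ) : Matrix (Γ ⊕ Γ) (Γ ⊕ Γ) ℝ :=
  Matrix.fromBlocks (-(Matrix.diagonal W.K * W.incidence)) (Matrix.diagonal W.K)
    0 (-(Matrix.diagonal W.H))

/-- The jump `(0, H a p)` of the state at a spatially uniform storm of depth `p`. -/
def stormJump (W : Watershed Γ) (p : ℝ) : FlowState Γ :=
  Sum.elim 0 (fun e => W.H e * W.a e * p)

/-- The matrix `u ^ (-Mᵀ / H_r) = exp (-(log u / H_r) Mᵀ)`, for `u > 0`. -/
noncomputable def powMatrix (W : Watershed Γ) (u : ℝ) : Matrix (Γ ⊕ Γ) (Γ ⊕ Γ) ℝ :=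
  NormedSpace.exp (-(Real.log u / W.H W.root) • W.driftMatrix.transpose)

/-- The vector `m_r(u)`: the second half of the column of `u ^ (-Mᵀ / H_r)` that corresponds to
the streamflow `Q_r` at the outlet. -/
noncomputable def outletResponse (W : Watershed Γ) (u : ℝ) : Γ → ℝ :=
  fun e => W.powMatrix u (Sum.inr e) (Sum.inl W.root)

/-- The integrand `[β ã · m_r(u)] ^ α / u` of the geomorphological coefficient `c_α`, where
`β_e = H_e / K_r` and `ã_e = a_e / a`. -/
noncomputable def geoIntegrand (W : Watershed Γ) (α u : ℝ) : ℝ :=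
  (∑ e, W.H e / W.K W.root * (W.a e / W.totalArea) * W.outletResponse u e) ^ α / u

/-- The geomorphological coefficient `c_α`. -/
noncomputable def geoCoeff (W : Watershed Γ) (α : ℝ) : ℝ :=
  ∫ u in Set.Ioo (0 : ℝ) 1, W.geoIntegrand α u

end Watershed

section Rainfall

variable {Ω : Type*} [MeasurableSpace Ω]

/-- Spatially uniform rainfall: the storm times `T 1 < T 2 < ⋯` are those of a Poisson process of
intensity `lam` (with `T 0 = 0`, the waiting times are independent and exponential), and the
storm depths `P 1, P 2, …` are positive, identically distributed, independent of each other and of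
the storm times. The variable `P 0` is not used. -/
structure IsUniformRainfall (μ : Measure Ω) (lam : ℝ) (T P : ℕ → Ω → ℝ) : Prop where
  measurable_time : ∀ n, Measurable (T n)
  measurable_depth : ∀ n, 1 ≤ n → Measurable (P n)
  time_zero : ∀ ω, T 0 ω = 0
  waiting_law : ∀ n, μ.map (fun ω => T (n + 1) ω - T n ω) = expMeasure lam
  depth_pos : ∀ n, 1 ≤ n → ∀ᵐ ω ∂μ, 0 < P n ω
  depth_law : ∀ n, 1 ≤ n → μ.map (P n) = μ.map (P 1)
  indep : iIndepFun (Sum.elim (fun (n : ℕ) ω => T (n + 1) ω - T n ω)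
    (fun (n : ℕ) => P (n + 1))) μ

/-- The number `N(t) = sup {n : T_n ≤ t}` of storms up to time `t`. -/
noncomputable def stormCount (T : ℕ → Ω → ℝ) (t : ℝ) (ω : Ω) : ℕ := sSup {n : ℕ | T n ω ≤ t}

variable {Γ : Type*} [Fintype Γ] [DecidableEq Γ]

/-- The driving compound Poisson process `Y(t) = ∑_{n = 1}^{N(t)} (0, H a P_n)`. -/
noncomputable def drivingProcess (W : Watershed Γ) (T P : ℕ → Ω → ℝ) (t : ℝ) (ω : Ω) :
    FlowState Γ :=
  ∑ n ∈ Finset.Icc 1 (stormCount T t ω), W.stormJump (P n ω)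

/-- `X x t` is, for each initial condition `x` in the state space, the value at time `t` of a
solution of `dX = M X dt + dY`, `X(0) = x`; that is, almost surely, for all `t ≥ 0`,
`X(t) = x + ∫₀ᵗ M X(s) ds + Y(t)`. -/
def IsFlowProcess (μ : Measure Ω) (W : Watershed Γ) (T P : ℕ → Ω → ℝ)
    (X : FlowState Γ → ℝ → Ω → FlowState Γ) : Prop :=
  ∀ x ∈ positiveOrthant Γ, ∀ᵐ ω ∂μ, ∀ t : ℝ, 0 ≤ t →
    IntervalIntegrable (fun s => W.driftMatrix.mulVec (X x s ω)) volume 0 t ∧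
    X x t ω = x + (∫ s in (0 : ℝ)..t, W.driftMatrix.mulVec (X x s ω)) + drivingProcess W T P t ω

/-- `g` is an invariant distribution on the state space for the transition probabilities
`p(t, x, A) = μ (X x t ∈ A)`. -/
structure IsInvariantDistribution (μ : Measure Ω) (X : FlowState Γ → ℝ → Ω → FlowState Γ)
    (g : Measure (FlowState Γ)) : Prop where
  isProbabilityMeasure : IsProbabilityMeasure g
  ae_mem : ∀ᵐ x ∂g, x ∈ positiveOrthant Γ
  invariant : ∀ t : ℝ, 0 < t → ∀ A : Set (FlowState Γ), MeasurableSet A →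
    A ⊆ positiveOrthant Γ → ∫⁻ x, μ {ω | X x t ω ∈ A} ∂g = g A

end Rainfall

/-- The index set of the Bell polynomial `B_{n,k}`: the vectors `(j_1, …, j_{n-k+1})` of natural
numbers with `∑ j_i = k` and `∑ i j_i = n`; the entry `j_i` is stored at position `i - 1`.
(The bound `j_i ≤ n` only makes the set visibly finite; it follows from the second equation.) -/
def bellIndices (n k : ℕ) : Finset (Fin (n - k + 1) → ℕ) :=
  (Fintype.piFinset fun _ => Finset.range (n + 1)).filter fun j =>
    ∑ i, j i = k ∧ ∑ i : Fin (n - k + 1), ((i : ℕ) + 1) * j i = n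

/-- The partial exponential Bell polynomial `B_{n,k}(x_1, …, x_{n-k+1})`, for `k ≤ n`. -/
noncomputable def bellPolynomial (n k : ℕ) (x : ℕ → ℝ) : ℝ :=
  (n.factorial : ℝ) * ∑ j ∈ bellIndices n k,
    ∏ i : Fin (n - k + 1), 1 / ((j i).factorial : ℝ) *
      (x ((i : ℕ) + 1) / (((i : ℕ) + 1).factorial : ℝ)) ^ j i

/-! The outlet flow is shot noise. Variation of constants gives X(t) = e^(tM) x + ∑ P_m e^((t -
T_m)M) j, summed over the storms up to t, where j is the jump of a unit storm. With φ(s) the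
Q_r-entry of e^(sM) j (`Watershed.impulse`), the storms contribute ∑ φ(t - T_m) P_m to Q_r. The
off-diagonal entries of M are nonnegative and M has a positive left sub-eigenvector with negative
eigenvalue (`Watershed.exists_lyapunov_vector`), so e^(sM) is nonnegative and decays exponentially.
Hence φ ≥ 0 and every positive power of φ is integrable on (0, ∞). The substitution u = e^(-H_r s)
turns c_α into H_r ∫ (φ / (a K_r))^α ds.

By the Laplace functional of the marked Poisson process, the storms up to t contribute exp(-λ ∫₀ᵗ (1
- E e^(-θ φ(s) P)) ds) to the Laplace transform of Q_r. Under g the initial state is independent of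
the storms and its own contribution tends to 1 as t → ∞. So E_g e^(-θ Q_r) = exp(-λ ∫ (1 - e^(-θ z))
ν(dz)), where ν is the image of ds × law(P₁) under (s, p) ↦ φ(s) p. The left side is positive, so
the integral converges with no moment condition on P₁ (`IsInvariantDistribution.integral_exp_neg`).

For θ > 0 both sides are smooth. Leibniz' rule applied to the logarithmic derivative gives a
recursion for the tilted moments E_g[Q_r^n e^(-θ Q_r)], and θ ↓ 0 gives, in [0, ∞], E Q^(n+1) = ∑
C(n,i) λ (∫ φ^(i+1)) (E P₁^(i+1)) E Q^(n-i) (`lintegral_pow_succ`). The term i = n shows that a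
finite moment of Q_r forces one of P₁; induction gives the converse. The same recursion
characterizes the complete Bell polynomials (`eq_sum_bellPolynomial_of_recursion`), and their
homogeneity produces the normalized coefficients c_i. -/

open scoped ENNReal

/-! ### Positivity and decay of matrix exponentials -/

section MatrixExponential

variable {ι : Type*} [Fintype ι] [DecidableEq ι]

open scoped Matrix.Norms.Operator in
/-- The entries of `exp (s M)` are differentiable in `s`. -/
theorem hasDerivAt_exp_smul_apply (M : Matrix ι ι ℝ) (i j : ι) (s : ℝ) :
    HasDerivAt (fun s : ℝ => NormedSpace.exp (s • M) i j)
      ((M * NormedSpace.exp (s • M)) i j) s := by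
  have h := hasDerivAt_exp_smul_const' (𝕂 := ℝ) M s
  exact (LinearMap.toContinuousLinearMap
    (Matrix.entryLinearMap ℝ ℝ i j)).hasFDerivAt.comp_hasDerivAt s h

theorem continuous_exp_smul_apply (M : Matrix ι ι ℝ) (i j : ι) :
    Continuous fun s : ℝ => NormedSpace.exp (s • M) i j :=
  continuous_iff_continuousAt.2 fun s => (hasDerivAt_exp_smul_apply M i j s).continuousAt

theorem hasDerivAt_exp_smul_mulVec (M : Matrix ι ι ℝ) (x : ι → ℝ) (s : ℝ) :
    HasDerivAt (fun s : ℝ => (NormedSpace.exp (s • M)).mulVec x)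
      (M.mulVec ((NormedSpace.exp (s • M)).mulVec x)) s := by
  rw [hasDerivAt_pi]
  intro i
  rw [Matrix.mulVec_mulVec]
  simp only [Matrix.mulVec, dotProduct]
  exact HasDerivAt.fun_sum fun j _ => (hasDerivAt_exp_smul_apply M i j s).mul_const (x j)

open scoped Matrix.Norms.Operator in
/-- The exponential of a matrix with nonnegative entries has nonnegative entries. -/
theorem Matrix.exp_nonneg_of_nonneg (A : Matrix ι ι ℝ) (hA : ∀ i j, 0 ≤ A i j) (i j : ι) :
    0 ≤ NormedSpace.exp A i j := by
  have hpow : ∀ n : ℕ, ∀ i j, 0 ≤ (A ^ n) i j := by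
    intro n
    induction n with
    | zero => intro i j; rw [pow_zero, Matrix.one_apply]; split_ifs <;> norm_num
    | succ n ih =>
      intro i j
      rw [pow_succ, Matrix.mul_apply]
      exact Finset.sum_nonneg fun k _ => mul_nonneg (ih i k) (hA k j)
  have h := NormedSpace.exp_series_hasSum_exp' (𝕂 := ℝ) A
  have h' := Pi.hasSum.1 (Pi.hasSum.1 h i) j
  exact h'.nonneg fun n => by
    simp only [Matrix.smul_apply, smul_eq_mul]
    exact mul_nonneg (by positivity) (hpow n i j)

/-- The exponential of a matrix with nonnegative off-diagonal entries has nonnegative entries. -/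
theorem Matrix.exp_smul_nonneg_of_metzler (M : Matrix ι ι ℝ) (hM : ∀ i j, i ≠ j → 0 ≤ M i j)
    {s : ℝ} (hs : 0 ≤ s) (i j : ι) : 0 ≤ NormedSpace.exp (s • M) i j := by
  -- Adding a large multiple c of the identity makes all entries nonnegative. The shift commutes
  -- with M, so it only contributes the positive scalar factor e^(-s c) to the exponential.
  obtain ⟨c, hc⟩ : ∃ c : ℝ, ∀ i, 0 ≤ M i i + c := by
    refine ⟨∑ k, |M k k|, fun i => ?_⟩
    have := Finset.single_le_sum (f := fun k => |M k k|) (fun k _ => abs_nonneg _)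
      (Finset.mem_univ i)
    have h2 := neg_abs_le (M i i)
    beta_reduce at this
    linarith
  have hdec : s • M = s • (M + c • (1 : Matrix ι ι ℝ)) +
      Matrix.diagonal (fun _ : ι => -(s * c)) := by
    ext a b
    by_cases hab : a = b
    · subst hab; simp
    · simp [hab]
  have hcomm : Commute (s • (M + c • (1 : Matrix ι ι ℝ)))
      (Matrix.diagonal (fun _ : ι => -(s * c))) := by
    have : Matrix.diagonal (fun _ : ι => -(s * c)) = (-(s * c)) • (1 : Matrix ι ι ℝ) := by
      ext a b
      by_cases hab : a = b
      · subst hab; simp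
      · simp [hab]
    rw [this]
    exact (Commute.one_right _).smul_right _
  rw [hdec, Matrix.exp_add_of_commute _ _ hcomm, Matrix.exp_diagonal, Matrix.mul_diagonal]
  refine mul_nonneg (Matrix.exp_nonneg_of_nonneg _ (fun a b => ?_) i j) ?_
  · simp only [Matrix.smul_apply, Matrix.add_apply, smul_eq_mul]
    refine mul_nonneg hs ?_
    by_cases hab : a = b
    · subst hab; simpa using hc a
    · simpa [hab] using hM a b hab
  · rw [Pi.coe_exp, ← Real.exp_eq_exp_ℝ]
    exact (Real.exp_pos _).le

/-- If `w` is nonnegative and `wᵀ M ≤ -δ wᵀ`, then `wᵀ exp (s M) ≤ e^(-δ s) wᵀ`. -/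
theorem Matrix.vecMul_exp_smul_le (M : Matrix ι ι ℝ) (hM : ∀ i j, i ≠ j → 0 ≤ M i j)
    (w : ι → ℝ) (δ : ℝ) (hwM : ∀ j, Matrix.vecMul w M j ≤ -δ * w j) {s : ℝ} (hs : 0 ≤ s) (j : ι) :
    Matrix.vecMul w (NormedSpace.exp (s • M)) j ≤ Real.exp (-δ * s) * w j := by
  -- It suffices that e^(δ s) wᵀ exp(s M) is nonincreasing in s: its derivative is e^(δ s) times the
  -- nonpositive row δ wᵀ + wᵀ M times the nonnegative matrix exp(s M).
  set G : ℝ → ℝ := fun s => Real.exp (δ * s) * Matrix.vecMul w (NormedSpace.exp (s • M)) j with hG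
  have hderiv : ∀ s, HasDerivAt G (Real.exp (δ * s) *
      Matrix.vecMul (δ • w + Matrix.vecMul w M) (NormedSpace.exp (s • M)) j) s := by
    intro s
    have h1 : HasDerivAt (fun s : ℝ => Real.exp (δ * s)) (Real.exp (δ * s) * δ) s := by
      simpa using ((hasDerivAt_id s).const_mul δ).exp
    have h2 : HasDerivAt (fun s : ℝ => Matrix.vecMul w (NormedSpace.exp (s • M)) j)
        (Matrix.vecMul w (M * NormedSpace.exp (s • M)) j) s := by
      simp only [Matrix.vecMul, dotProduct]
      exact HasDerivAt.fun_sum fun i _ => (hasDerivAt_exp_smul_apply M i j s).const_mul (w i)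
    refine (h1.mul h2).congr_deriv ?_
    rw [Matrix.add_vecMul, Matrix.smul_vecMul, Matrix.vecMul_vecMul]
    simp only [Pi.add_apply, Pi.smul_apply, smul_eq_mul]
    ring
  have hanti : AntitoneOn G (Set.Ici 0) := by
    refine antitoneOn_of_deriv_nonpos (convex_Ici 0)
      (fun s _ => (hderiv s).continuousAt.continuousWithinAt)
      (fun s _ => (hderiv s).differentiableAt.differentiableWithinAt) fun s hs => ?_
    rw [interior_Ici] at hs
    rw [(hderiv s).deriv]
    refine mul_nonpos_of_nonneg_of_nonpos (Real.exp_pos _).le ?_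
    refine Finset.sum_nonpos fun i _ => mul_nonpos_of_nonpos_of_nonneg ?_
      (Matrix.exp_smul_nonneg_of_metzler M hM (le_of_lt hs) i j)
    have := hwM i
    simp only [Pi.add_apply, Pi.smul_apply, smul_eq_mul]
    linarith
  have h := hanti (Set.self_mem_Ici) hs hs
  simp only [hG, zero_smul, NormedSpace.exp_zero, mul_zero, Real.exp_zero, Matrix.vecMul_one,
    one_mul] at h
  have hpos := Real.exp_pos (-δ * s)
  calc _ = Real.exp (-δ * s) * (Real.exp (δ * s) *
        Matrix.vecMul w (NormedSpace.exp (s • M)) j) := by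
        rw [← mul_assoc, ← Real.exp_add]; simp
    _ ≤ _ := by gcongr

end MatrixExponential

/-! ### The river network: Lyapunov weights and the impulse response -/

section Network

variable {Γ : Type*} [Fintype Γ] [DecidableEq Γ]

/-- There is a positive function on the links that drops by at least one along the flow. -/
theorem RiverNetwork.exists_height (N : RiverNetwork Γ) :
    ∃ z : Γ → ℝ, (∀ e, 1 ≤ z e) ∧ ∀ e f, N.down f = some e → z e + 1 ≤ z f := by
  let step : Option Γ → Option Γ := fun o => o.bind N.down
  have hreach : ∀ e, ∃ n : ℕ, step^[n] (some e) = some N.root := by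
    intro e
    induction N.reaches_root e using Relation.ReflTransGen.head_induction_on with
    | refl => exact ⟨0, rfl⟩
    | head h _ ih =>
      obtain ⟨n, hn⟩ := ih
      refine ⟨n + 1, ?_⟩
      rw [Function.iterate_succ_apply]
      simpa [step, h] using hn
  classical
  -- The height is one plus the number of steps to the root.
  refine ⟨fun e => (Nat.find (hreach e) : ℝ) + 1, fun e => by simp, fun e f hef => ?_⟩
  have hf := Nat.find_spec (hreach f)
  obtain ⟨k, hk⟩ : ∃ k, Nat.find (hreach f) = k + 1 := by
    refine Nat.exists_eq_succ_of_ne_zero fun h0 => ?_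
    rw [h0] at hf
    have : f = N.root := by simpa using hf
    rw [this, N.down_root] at hef
    simp at hef
  rw [hk, Function.iterate_succ_apply] at hf
  have hle : Nat.find (hreach e) ≤ k := Nat.find_min' _ (by simpa [step, hef] using hf)
  simp only [hk]
  push_cast
  have : (Nat.find (hreach e) : ℝ) ≤ k := by exact_mod_cast hle
  linarith

namespace Watershed

theorem totalArea_pos (W : Watershed Γ) : 0 < W.totalArea :=
  Finset.sum_pos (fun e _ => W.a_pos e) ⟨W.root, Finset.mem_univ _⟩

theorem driftMatrix_inl_inl (W : Watershed Γ) (e f : Γ) :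
    W.driftMatrix (Sum.inl e) (Sum.inl f) =
      if e = f then -W.K e else if W.down f = some e then W.K e else 0 := by
  simp only [driftMatrix, Matrix.fromBlocks_apply₁₁, Matrix.neg_apply, Matrix.diagonal_mul,
    RiverNetwork.incidence, Matrix.of_apply]
  split_ifs <;> simp

theorem driftMatrix_inl_inr (W : Watershed Γ) (e f : Γ) :
    W.driftMatrix (Sum.inl e) (Sum.inr f) = if e = f then W.K e else 0 := by
  simp [driftMatrix, Matrix.diagonal_apply]

theorem driftMatrix_inr_inl (W : Watershed Γ) (e f : Γ) :
    W.driftMatrix (Sum.inr e) (Sum.inl f) = 0 := by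
  simp [driftMatrix]

theorem driftMatrix_inr_inr (W : Watershed Γ) (e f : Γ) :
    W.driftMatrix (Sum.inr e) (Sum.inr f) = if e = f then -W.H e else 0 := by
  simp only [driftMatrix, Matrix.fromBlocks_apply₂₂, Matrix.neg_apply, Matrix.diagonal_apply]
  split_ifs <;> simp

theorem driftMatrix_metzler (W : Watershed Γ) (i j : Γ ⊕ Γ) (hij : i ≠ j) :
    0 ≤ W.driftMatrix i j := by
  rcases i with e | e <;> rcases j with f | f
  · have : e ≠ f := fun h => hij (by rw [h])
    rw [driftMatrix_inl_inl, if_neg this]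
    split_ifs
    · exact (W.K_pos e).le
    · exact le_rfl
  · rw [driftMatrix_inl_inr]
    split_ifs
    · exact (W.K_pos e).le
    · exact le_rfl
  · rw [driftMatrix_inr_inl]
  · have : e ≠ f := fun h => hij (by rw [h])
    rw [driftMatrix_inr_inr, if_neg this]

/-- The fundamental matrix `exp (s M)` of the system. -/
noncomputable def flowMatrix (W : Watershed Γ) (s : ℝ) : Matrix (Γ ⊕ Γ) (Γ ⊕ Γ) ℝ :=
  NormedSpace.exp (s • W.driftMatrix)

theorem flowMatrix_nonneg (W : Watershed Γ) {s : ℝ} (hs : 0 ≤ s) (i j : Γ ⊕ Γ) :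
    0 ≤ W.flowMatrix s i j :=
  Matrix.exp_smul_nonneg_of_metzler _ W.driftMatrix_metzler hs i j

/-- A positive left sub-eigenvector of the drift matrix with negative eigenvalue. -/
theorem exists_lyapunov_vector (W : Watershed Γ) :
    ∃ (w : Γ ⊕ Γ → ℝ) (δ : ℝ), (∀ i, 0 < w i) ∧ 0 < δ ∧
      ∀ j, Matrix.vecMul w W.driftMatrix j ≤ -δ * w j := by
  obtain ⟨z, hz1, hz⟩ := W.exists_height
  -- Dividing by the rates makes every column of wᵀ M at most -1. Column Q_f gives z at the
  -- downstream link (0 at the root) minus z_f, and column R_f gives z_f - (z_f + 1). With δ the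
  -- reciprocal of the total weight, δ w_j ≤ 1.
  let w : Γ ⊕ Γ → ℝ := Sum.elim (fun e => z e / W.K e) (fun e => (z e + 1) / W.H e)
  have hw : ∀ i, 0 < w i := by
    rintro (e | e)
    · exact div_pos (by linarith [hz1 e]) (W.K_pos e)
    · exact div_pos (by linarith [hz1 e]) (W.H_pos e)
  have hsum : 0 < ∑ i, w i := Finset.sum_pos (fun i _ => hw i) ⟨Sum.inl W.root, Finset.mem_univ _⟩
  refine ⟨w, (∑ i, w i)⁻¹, hw, inv_pos.2 hsum, fun j => ?_⟩
  have hcol : Matrix.vecMul w W.driftMatrix j ≤ -1 := by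
    simp only [Matrix.vecMul, dotProduct, Fintype.sum_sum_type]
    rcases j with f | f
    · simp only [driftMatrix_inl_inl, driftMatrix_inr_inl, mul_zero, Finset.sum_const_zero,
        add_zero]
      have hterm : ∀ e, w (Sum.inl e) * (if e = f then -W.K e else
          if W.down f = some e then W.K e else 0) =
          (if e = f then -z e else 0) + (if W.down f = some e then z e else 0) := by
        intro e
        have hK := (W.K_pos e).ne'
        have hloop : ∀ e, W.down e ≠ some e := fun e h => by linarith [hz e e h]
        by_cases h1 : e = f
        · subst h1; simp [w, hloop]; field_simp
        · by_cases h2 : W.down f = some e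
          · simp [w, h1, h2]; field_simp
          · simp [h1, h2]
      rw [Finset.sum_congr rfl fun e _ => hterm e, Finset.sum_add_distrib]
      simp only [Finset.sum_ite_eq', Finset.mem_univ, if_true]
      rcases hd : W.down f with _ | e
      · simp; linarith [hz1 f]
      · simp; linarith [hz e f hd]
    · simp only [driftMatrix_inl_inr, driftMatrix_inr_inr]
      have hK := (W.K_pos f).ne'
      have hH := (W.H_pos f).ne'
      simp [w]
      field_simp
      linarith
  have hle : (∑ i, w i)⁻¹ * w j ≤ 1 := by
    rw [inv_mul_le_iff₀ hsum, mul_one]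
    exact Finset.single_le_sum (fun i _ => (hw i).le) (Finset.mem_univ j)
  linarith

/-- The fundamental matrix decays exponentially. -/
theorem exists_flowMatrix_le (W : Watershed Γ) :
    ∃ C δ : ℝ, 0 < C ∧ 0 < δ ∧ ∀ s, 0 ≤ s → ∀ i j, W.flowMatrix s i j ≤ C * Real.exp (-δ * s) := by
  obtain ⟨w, δ, hw, hδ, hwM⟩ := W.exists_lyapunov_vector
  have hpos : ∀ i j, 0 < w j / w i := fun i j => div_pos (hw j) (hw i)
  refine ⟨∑ i, ∑ j, w j / w i, δ, ?_, hδ, fun s hs i j => ?_⟩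
  · have hne : (Finset.univ : Finset (Γ ⊕ Γ)).Nonempty := ⟨Sum.inl W.root, Finset.mem_univ _⟩
    exact Finset.sum_pos (fun i _ => Finset.sum_pos (fun j _ => hpos i j) hne) hne
  · have h1 := Matrix.vecMul_exp_smul_le W.driftMatrix W.driftMatrix_metzler w δ hwM hs j
    have h2 : w i * W.flowMatrix s i j ≤ Matrix.vecMul w (W.flowMatrix s) j :=
      Finset.single_le_sum (f := fun i => w i * W.flowMatrix s i j)
        (fun i _ => mul_nonneg (hw i).le (W.flowMatrix_nonneg hs i j)) (Finset.mem_univ i)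
    have h3 : w j / w i ≤ ∑ i, ∑ j, w j / w i :=
      (Finset.single_le_sum (f := fun j => w j / w i) (fun j _ => (hpos i j).le)
        (Finset.mem_univ j)).trans
      (Finset.single_le_sum (f := fun i => ∑ j, w j / w i)
        (fun i _ => Finset.sum_nonneg fun j _ => (hpos i j).le) (Finset.mem_univ i))
    have h4 : W.flowMatrix s i j ≤ w j / w i * Real.exp (-δ * s) := by
      rw [div_mul_eq_mul_div, le_div_iff₀ (hw i)]
      unfold flowMatrix at h2 ⊢
      linarith
    exact h4.trans (by gcongr)

/-- The streamflow at the outlet, a time `s` after a storm of unit depth. -/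
noncomputable def impulse (W : Watershed Γ) (s : ℝ) : ℝ :=
  (W.flowMatrix s).mulVec (W.stormJump 1) (Sum.inl W.root)

theorem impulse_eq (W : Watershed Γ) (s : ℝ) :
    W.impulse s = ∑ e, W.flowMatrix s (Sum.inl W.root) (Sum.inr e) * (W.H e * W.a e) := by
  simp [impulse, Matrix.mulVec, dotProduct, stormJump]

theorem continuous_impulse (W : Watershed Γ) : Continuous W.impulse := by
  simp only [funext W.impulse_eq]
  exact continuous_finsetSum _ fun e _ => (continuous_exp_smul_apply _ _ _).mul continuous_const

theorem impulse_nonneg (W : Watershed Γ) {s : ℝ} (hs : 0 ≤ s) : 0 ≤ W.impulse s := by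
  rw [impulse_eq]
  exact Finset.sum_nonneg fun e _ => mul_nonneg (W.flowMatrix_nonneg hs _ _)
    (mul_pos (W.H_pos e) (W.a_pos e)).le

theorem exists_impulse_le (W : Watershed Γ) :
    ∃ C δ : ℝ, 0 < C ∧ 0 < δ ∧ ∀ s, 0 ≤ s → W.impulse s ≤ C * Real.exp (-δ * s) := by
  obtain ⟨C, δ, hC, hδ, h⟩ := W.exists_flowMatrix_le
  have hHa : 0 < ∑ e, W.H e * W.a e :=
    Finset.sum_pos (fun e _ => mul_pos (W.H_pos e) (W.a_pos e)) ⟨W.root, Finset.mem_univ _⟩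
  refine ⟨C * ∑ e, W.H e * W.a e, δ, mul_pos hC hHa, hδ, fun s hs => ?_⟩
  rw [impulse_eq, mul_right_comm, Finset.mul_sum]
  exact Finset.sum_le_sum fun e _ => mul_le_mul_of_nonneg_right (h s hs _ _)
    (mul_pos (W.H_pos e) (W.a_pos e)).le

/-- The response starts at 0 with slope K_r H_r a_r > 0, due to the hillslope of the root link. Were
it nowhere positive, it would vanish on [0, ∞) and its slope at 0 would be 0. -/
theorem exists_impulse_pos (W : Watershed Γ) : ∃ s, 0 < s ∧ 0 < W.impulse s := by
  have hd : HasDerivAt W.impulse (W.K W.root * (W.H W.root * W.a W.root)) 0 := by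
    have h := hasDerivAt_pi.1 (hasDerivAt_exp_smul_mulVec W.driftMatrix (W.stormJump 1) 0)
      (Sum.inl W.root)
    refine h.congr_deriv ?_
    rw [zero_smul, NormedSpace.exp_zero, Matrix.one_mulVec]
    simp [Matrix.mulVec, dotProduct, stormJump, driftMatrix_inl_inr]
  have h0 : W.impulse 0 = 0 := by simp [impulse, flowMatrix, stormJump]
  by_contra! hcon
  have hzero : ∀ s, 0 ≤ s → W.impulse s = 0 := fun s hs => by
    rcases hs.eq_or_lt with rfl | h
    · exact h0
    · exact le_antisymm (hcon s h) (W.impulse_nonneg hs)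
  have h1 : HasDerivWithinAt W.impulse 0 (Set.Ici 0) 0 :=
    (hasDerivWithinAt_const (0 : ℝ) (Set.Ici 0) (0 : ℝ)).congr (fun s hs => hzero s hs) h0
  have h2 := (uniqueDiffWithinAt_Ici (0 : ℝ)).eq_deriv _ h1 hd.hasDerivWithinAt
  have := mul_pos (W.K_pos W.root) (mul_pos (W.H_pos W.root) (W.a_pos W.root))
  linarith

end Watershed

end Network

/-! ### The geomorphological coefficients as integrals of the impulse response -/

section GeoCoeff

variable {Γ : Type*} [Fintype Γ] [DecidableEq Γ]

namespace Watershed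

theorem outletResponse_eq (W : Watershed Γ) (u : ℝ) (e : Γ) :
    W.outletResponse u e =
      W.flowMatrix (-Real.log u / W.H W.root) (Sum.inl W.root) (Sum.inr e) := by
  rw [outletResponse, powMatrix, ← Matrix.transpose_smul, Matrix.exp_transpose,
    Matrix.transpose_apply, flowMatrix, neg_div]

/-- The base of the integrand of `c_α` is the normalized impulse response. -/
theorem geoIntegrand_eq (W : Watershed Γ) (α u : ℝ) :
    W.geoIntegrand α u =
      (W.impulse (-Real.log u / W.H W.root) / (W.totalArea * W.K W.root)) ^ α / u := by
  have h1 := W.totalArea_pos.ne'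
  have h2 := (W.K_pos W.root).ne'
  rw [geoIntegrand, impulse_eq, Finset.sum_div]
  congr 2
  refine Finset.sum_congr rfl fun e _ => ?_
  rw [outletResponse_eq]
  field_simp

theorem exp_neg_mul_image_Ioi {H : ℝ} (hH : 0 < H) :
    (fun s : ℝ => Real.exp (-H * s)) '' Set.Ioi 0 = Set.Ioo 0 1 := by
  ext u
  constructor
  · rintro ⟨s, hs, rfl⟩
    exact ⟨Real.exp_pos _, by rw [Real.exp_lt_one_iff]; have := mul_pos hH hs; linarith⟩
  · rintro ⟨h0, h1⟩
    refine ⟨-Real.log u / H, div_pos (neg_pos.2 (Real.log_neg h0 h1)) hH, ?_⟩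
    have : -H * (-Real.log u / H) = Real.log u := by field_simp
    simp only [this, Real.exp_log h0]

theorem hasDerivAt_exp_neg_mul (H s : ℝ) :
    HasDerivAt (fun s : ℝ => Real.exp (-H * s)) (Real.exp (-H * s) * (-H)) s := by
  simpa using ((hasDerivAt_id s).const_mul (-H)).exp

theorem injective_exp_neg_mul {H : ℝ} (hH : 0 < H) :
    Function.Injective fun s : ℝ => Real.exp (-H * s) := fun a b hab => by
  have := Real.exp_injective hab
  exact mul_left_cancel₀ (neg_ne_zero.2 hH.ne') this

/-- Under u = e^(-H_r s) the Jacobian H_r u cancels the factor 1/u of the integrand, and the matrix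
power becomes the flow at time s. -/
theorem abs_deriv_smul_geoIntegrand (W : Watershed Γ) (α s : ℝ) :
    |Real.exp (-W.H W.root * s) * (-W.H W.root)| •
        W.geoIntegrand α (Real.exp (-W.H W.root * s)) =
      W.H W.root * (W.impulse s / (W.totalArea * W.K W.root)) ^ α := by
  have hH := W.H_pos W.root
  have hs : -Real.log (Real.exp (-W.H W.root * s)) / W.H W.root = s := by
    rw [Real.log_exp]; field_simp
  rw [geoIntegrand_eq, hs, mul_neg, abs_neg, abs_of_pos (mul_pos (Real.exp_pos _) hH), smul_eq_mul]
  have := (Real.exp_pos (-W.H W.root * s)).ne'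
  field_simp

theorem integrableOn_impulse_rpow (W : Watershed Γ) {α c : ℝ} (hα : 0 < α) (hc : 0 < c) :
    IntegrableOn (fun s => (W.impulse s / c) ^ α) (Set.Ioi 0) := by
  obtain ⟨C, δ, hC, hδ, hle⟩ := W.exists_impulse_le
  have hexp : IntegrableOn (fun s => (C / c) ^ α * Real.exp (-(δ * α) * s)) (Set.Ioi 0) :=
    (integrableOn_exp_mul_Ioi (by nlinarith [mul_pos hδ hα]) 0).const_mul _
  refine hexp.mono' ?_ ?_
  · exact ((W.continuous_impulse.div_const c).rpow_const
      fun _ => Or.inr hα.le).aestronglyMeasurable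
  · refine (ae_restrict_mem measurableSet_Ioi).mono fun s hs => ?_
    have h0 : 0 ≤ W.impulse s / c := div_nonneg (W.impulse_nonneg (le_of_lt hs)) hc.le
    rw [Real.norm_of_nonneg (Real.rpow_nonneg h0 _)]
    calc (W.impulse s / c) ^ α ≤ (C / c * Real.exp (-δ * s)) ^ α := by
          refine Real.rpow_le_rpow h0 ?_ hα.le
          rw [div_mul_eq_mul_div]
          exact div_le_div_of_nonneg_right (hle s (le_of_lt hs)) hc.le
      _ = _ := by
          rw [Real.mul_rpow (by positivity) (Real.exp_pos _).le, ← Real.exp_mul]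
          ring_nf

theorem integrableOn_geoIntegrand (W : Watershed Γ) {α : ℝ} (hα : 0 < α) :
    IntegrableOn (W.geoIntegrand α) (Set.Ioo 0 1) := by
  have hH := W.H_pos W.root
  rw [← exp_neg_mul_image_Ioi hH, integrableOn_image_iff_integrableOn_abs_deriv_smul
    measurableSet_Ioi (fun s _ => (hasDerivAt_exp_neg_mul _ s).hasDerivWithinAt)
    (injective_exp_neg_mul hH).injOn]
  simp only [abs_deriv_smul_geoIntegrand]
  exact (W.integrableOn_impulse_rpow hα
    (mul_pos W.totalArea_pos (W.K_pos W.root))).const_mul _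

theorem integrableOn_impulse_pow (W : Watershed Γ) {i : ℕ} (hi : 1 ≤ i) :
    IntegrableOn (fun s => W.impulse s ^ i) (Set.Ioi 0) := by
  have h := W.integrableOn_impulse_rpow (α := i) (c := 1) (by exact_mod_cast hi) one_pos
  simpa only [div_one, Real.rpow_natCast] using h

/-- The coefficients `c_i` are the normalized power integrals of the impulse response. -/
theorem geoCoeff_natCast (W : Watershed Γ) (i : ℕ) :
    W.geoCoeff i = W.H W.root / (W.totalArea * W.K W.root) ^ i *
      ∫ s in Set.Ioi (0 : ℝ), W.impulse s ^ i := by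
  have hH := W.H_pos W.root
  rw [geoCoeff, ← exp_neg_mul_image_Ioi hH, integral_image_eq_integral_abs_deriv_smul
    measurableSet_Ioi (fun s _ => (hasDerivAt_exp_neg_mul _ s).hasDerivWithinAt)
    (injective_exp_neg_mul hH).injOn]
  simp only [abs_deriv_smul_geoIntegrand, Real.rpow_natCast, div_pow]
  rw [← integral_const_mul]
  congr 1
  ext s
  ring

/-- By continuity, one positive value of the response makes it positive on an open set. Positivity
is what allows depth moments to be read off from flow moments. -/
theorem integral_impulse_pow_pos (W : Watershed Γ) {i : ℕ} (hi : 1 ≤ i) :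
    0 < ∫ s in Set.Ioi (0 : ℝ), W.impulse s ^ i := by
  obtain ⟨s, hs, hpos⟩ := W.exists_impulse_pos
  rw [setIntegral_pos_iff_support_of_nonneg_ae
    ((ae_restrict_mem measurableSet_Ioi).mono fun s hs =>
      pow_nonneg (W.impulse_nonneg (le_of_lt hs)) i)
    (W.integrableOn_impulse_pow hi)]
  have hopen : IsOpen ({s | 0 < W.impulse s} ∩ Set.Ioi 0) :=
    (isOpen_lt continuous_const W.continuous_impulse).inter isOpen_Ioi
  exact (hopen.measure_pos volume ⟨s, hpos, hs⟩).trans_le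
    (measure_mono (Set.inter_subset_inter_left _ fun s hs => (pow_pos hs i).ne'))

end Watershed

end GeoCoeff

/-! ### Variation of constants for linear systems with jumps -/

section LinearIntegralEquation

variable {ι : Type*} [Fintype ι]

/-- The linear integral equation `D(s) = ∫₀ˢ M D` has only the trivial solution. -/
theorem eq_zero_of_eq_integral_mulVec (M : Matrix ι ι ℝ) (D : ℝ → ι → ℝ) {t : ℝ} (ht : 0 ≤ t)
    (hInt : IntervalIntegrable (fun s => M.mulVec (D s)) volume 0 t)
    (hD : ∀ s ∈ Set.Icc 0 t, D s = ∫ r in (0 : ℝ)..s, M.mulVec (D r)) : D t = 0 := by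
  have hcont : ContinuousOn D (Set.Icc 0 t) := by
    have h := intervalIntegral.continuousOn_primitive_interval' hInt Set.left_mem_uIcc
    rw [Set.uIcc_of_le ht] at h
    exact h.congr hD
  -- Only D on [0, t] is controlled. Extending it by its endpoint values makes the primitive F of M
  -- E differentiable everywhere, and on [0, t] F equals D and solves F' = M F.
  set E : ℝ → ι → ℝ := fun s => D (Set.projIcc 0 t ht s) with hE
  have hEc : Continuous E := by
    have := hcont.domRestrict.comp (continuous_projIcc (h := ht))
    exact this
  have hED : ∀ s ∈ Set.Icc 0 t, E s = D s := fun s hs => by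
    simp only [hE, Set.projIcc_of_mem ht hs]
  have hMc : Continuous fun s => M.mulVec (E s) := continuous_const.matrix_mulVec hEc
  set F : ℝ → ι → ℝ := fun s => ∫ r in (0 : ℝ)..s, M.mulVec (E r) with hF
  have hFD : ∀ s ∈ Set.Icc 0 t, F s = D s := fun s hs => by
    rw [hD s hs]
    refine intervalIntegral.integral_congr fun r hr => ?_
    rw [Set.uIcc_of_le hs.1] at hr
    simp only [hED r ⟨hr.1, hr.2.trans hs.2⟩]
  have hFd : ∀ s, HasDerivAt F (M.mulVec (E s)) s := fun s =>
    intervalIntegral.integral_hasDerivAt_right (hMc.intervalIntegrable _ _)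
      (hMc.stronglyMeasurableAtFilter _ _) hMc.continuousAt
  let L : (ι → ℝ) →L[ℝ] (ι → ℝ) := LinearMap.toContinuousLinearMap (Matrix.mulVecLin M)
  have huniq : Set.EqOn F (fun _ => 0) (Set.Icc 0 t) := by
    refine ODE_solution_unique (v := fun _ x => M.mulVec x) (K := ‖L‖₊) (fun _ => L.lipschitz)
      (fun s _ => (hFd s).continuousAt.continuousWithinAt) (fun s hs => ?_)
      continuousOn_const (fun s _ => ?_) (by simp [hF])
    · have hs' : s ∈ Set.Icc 0 t := ⟨hs.1, hs.2.le⟩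
      simp only [hFD s hs', ← hED s hs']
      exact (hFd s).hasDerivWithinAt
    · simpa using hasDerivWithinAt_const s (Set.Ici s) (0 : ι → ℝ)
  rw [← hFD t ⟨ht, le_rfl⟩]
  exact huniq ⟨ht, le_rfl⟩

variable [DecidableEq ι]

theorem continuous_mulVec_exp_smul_mulVec (M : Matrix ι ι ℝ) (x : ι → ℝ) :
    Continuous fun s : ℝ => M.mulVec ((NormedSpace.exp (s • M)).mulVec x) :=
  continuous_const.matrix_mulVec (continuous_iff_continuousAt.2 fun s =>
    (hasDerivAt_exp_smul_mulVec M x s).continuousAt)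

theorem integral_mulVec_exp_smul_mulVec (M : Matrix ι ι ℝ) (x : ι → ℝ) (s : ℝ) :
    ∫ r in (0 : ℝ)..s, M.mulVec ((NormedSpace.exp (r • M)).mulVec x) =
      (NormedSpace.exp (s • M)).mulVec x - x := by
  rw [intervalIntegral.integral_eq_sub_of_hasDerivAt
    (fun r _ => hasDerivAt_exp_smul_mulVec M x r)
    ((continuous_mulVec_exp_smul_mulVec M x).intervalIntegrable _ _)]
  simp

/-- The response to a jump `x` at time `τ`. -/
noncomputable def jumpResponse (M : Matrix ι ι ℝ) (x : ι → ℝ) (τ s : ℝ) : ι → ℝ :=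
  if τ ≤ s then (NormedSpace.exp ((s - τ) • M)).mulVec x else 0

theorem intervalIntegrable_mulVec_jumpResponse (M : Matrix ι ι ℝ) (x : ι → ℝ) (τ a b : ℝ) :
    IntervalIntegrable (fun s => M.mulVec (jumpResponse M x τ s)) volume a b := by
  have h : (fun s => M.mulVec (jumpResponse M x τ s)) =
      (Set.Ici τ).indicator fun s => M.mulVec ((NormedSpace.exp ((s - τ) • M)).mulVec x) := by
    ext1 s
    by_cases hs : τ ≤ s
    · rw [Set.indicator_of_mem (show s ∈ Set.Ici τ from hs), jumpResponse, if_pos hs]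
    · rw [Set.indicator_of_notMem (show s ∉ Set.Ici τ from hs), jumpResponse, if_neg hs,
        Matrix.mulVec_zero]
  rw [h, intervalIntegrable_iff]
  have hc : Continuous fun s => M.mulVec ((NormedSpace.exp ((s - τ) • M)).mulVec x) :=
    (continuous_mulVec_exp_smul_mulVec M x).comp (continuous_id.sub continuous_const)
  exact ((intervalIntegrable_iff.1 (hc.intervalIntegrable a b)).indicator measurableSet_Ici)

theorem integral_mulVec_jumpResponse (M : Matrix ι ι ℝ) (x : ι → ℝ) {τ s : ℝ} (hτ : 0 ≤ τ)
    (hs : 0 ≤ s) :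
    ∫ r in (0 : ℝ)..s, M.mulVec (jumpResponse M x τ r) =
      jumpResponse M x τ s - if τ ≤ s then x else 0 := by
  have hzero : ∀ b, b ≤ τ → 0 ≤ b → ∫ r in (0 : ℝ)..b, M.mulVec (jumpResponse M x τ r) = 0 := by
    intro b hb hb0
    refine intervalIntegral.integral_zero_ae ?_
    -- At r = τ the response is already the jump, so the integrand vanishes only off this null set.
    have hne : ∀ᵐ r : ℝ, r ≠ τ := by simp [ae_iff]
    filter_upwards [hne] with r hr hmem
    rw [Set.uIoc_of_le hb0] at hmem
    have : ¬ τ ≤ r := fun h => hr (le_antisymm (hmem.2.trans hb) h)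
    rw [jumpResponse, if_neg this, Matrix.mulVec_zero]
  by_cases h : τ ≤ s
  · rw [← intervalIntegral.integral_add_adjacent_intervals
      (intervalIntegrable_mulVec_jumpResponse M x τ 0 τ)
      (intervalIntegrable_mulVec_jumpResponse M x τ τ s), hzero τ le_rfl hτ, zero_add]
    have hcongr : ∫ r in τ..s, M.mulVec (jumpResponse M x τ r) =
        ∫ r in τ..s, M.mulVec ((NormedSpace.exp ((r - τ) • M)).mulVec x) := by
      refine intervalIntegral.integral_congr fun r hr => ?_
      rw [Set.uIcc_of_le h] at hr
      simp only [jumpResponse, if_pos hr.1]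
    rw [hcongr, intervalIntegral.integral_comp_sub_right
      (fun r => M.mulVec ((NormedSpace.exp (r • M)).mulVec x)), sub_self,
      integral_mulVec_exp_smul_mulVec, jumpResponse, if_pos h, if_pos h]
  · rw [hzero s (le_of_not_ge h) hs, jumpResponse, if_neg h, if_neg h, sub_zero]

/-- Variation of constants for a linear system driven by finitely many jumps. -/
theorem eq_of_eq_integral_add_jumps (M : Matrix ι ι ℝ) (x : ι → ℝ) (X : ℝ → ι → ℝ)
    {κ : Type*} (S : Finset κ) (τ : κ → ℝ) (J : κ → ι → ℝ) (hτ : ∀ m ∈ S, 0 ≤ τ m)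
    {t : ℝ} (ht : 0 ≤ t) (hInt : IntervalIntegrable (fun s => M.mulVec (X s)) volume 0 t)
    (hX : ∀ s ∈ Set.Icc 0 t, X s = x + (∫ r in (0 : ℝ)..s, M.mulVec (X r)) +
      ∑ m ∈ S, if τ m ≤ s then J m else 0) :
    X t = (NormedSpace.exp (t • M)).mulVec x + ∑ m ∈ S, jumpResponse M (J m) (τ m) t := by
  -- By superposition the explicit candidate Z satisfies the same integral equation, so X - Z
  -- satisfies the homogeneous one.
  set Z : ℝ → ι → ℝ := fun s =>
    (NormedSpace.exp (s • M)).mulVec x + ∑ m ∈ S, jumpResponse M (J m) (τ m) s with hZ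
  have hMZ : ∀ s, M.mulVec (Z s) = M.mulVec ((NormedSpace.exp (s • M)).mulVec x) +
      ∑ m ∈ S, M.mulVec (jumpResponse M (J m) (τ m) s) := fun s => by
    rw [hZ, Matrix.mulVec_add, Matrix.mulVec_sum]
  have hi1 : ∀ s, IntervalIntegrable
      (fun s => M.mulVec ((NormedSpace.exp (s • M)).mulVec x)) volume 0 s :=
    fun s => (continuous_mulVec_exp_smul_mulVec M x).intervalIntegrable _ _
  have hi2 : ∀ s, IntervalIntegrable
      (fun s => ∑ m ∈ S, M.mulVec (jumpResponse M (J m) (τ m) s)) volume 0 s := fun s => by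
    have := IntervalIntegrable.sum (μ := volume) (a := 0) (b := s) S
      (f := fun m s => M.mulVec (jumpResponse M (J m) (τ m) s))
      fun m _ => intervalIntegrable_mulVec_jumpResponse M (J m) (τ m) 0 s
    simpa only [Finset.sum_fn] using this
  have hZint : ∀ s, IntervalIntegrable (fun s => M.mulVec (Z s)) volume 0 s := fun s => by
    simp only [hMZ]
    exact (hi1 s).add (hi2 s)
  have hZeq : ∀ s, 0 ≤ s → ∫ r in (0 : ℝ)..s, M.mulVec (Z r) =
      Z s - x - ∑ m ∈ S, if τ m ≤ s then J m else 0 := fun s hs => by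
    simp only [hMZ]
    rw [intervalIntegral.integral_add (hi1 s) (hi2 s), integral_mulVec_exp_smul_mulVec,
      intervalIntegral.integral_finsetSum fun m _ =>
        intervalIntegrable_mulVec_jumpResponse M (J m) (τ m) 0 s,
      Finset.sum_congr rfl fun m hm => integral_mulVec_jumpResponse M (J m) (hτ m hm) hs,
      Finset.sum_sub_distrib]
    simp only [hZ]
    abel
  have hdiff := eq_zero_of_eq_integral_mulVec M (fun s => X s - Z s) ht
    (by simp only [Matrix.mulVec_sub]; exact hInt.sub (hZint t)) fun s hs => by
      have hsub : IntervalIntegrable (fun s => M.mulVec (X s)) volume 0 s :=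
        hInt.mono_set (by
          rw [Set.uIcc_of_le hs.1, Set.uIcc_of_le ht]
          exact Set.Icc_subset_Icc_right hs.2)
      simp only [Matrix.mulVec_sub]
      rw [intervalIntegral.integral_sub hsub (hZint s), hZeq s hs.1]
      conv_lhs => rw [hX s hs]
      abel
  exact sub_eq_zero.1 hdiff

end LinearIntegralEquation

/-! ### Storm counts and the explicit form of the flow -/

section Storms

variable {Ω : Type*} {Γ : Type*} [Fintype Γ] [DecidableEq Γ]

/-- The supremum of an unbounded set of naturals is 0 by convention, so `stormCount` really counts
only once some storm time exceeds s; `hn` provides this. The set is nonempty because `T 0 ω = 0 ≤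
s`. -/
theorem le_stormCount_iff {T : ℕ → Ω → ℝ} {ω : Ω} (hT : Monotone fun n => T n ω)
    (h0 : T 0 ω = 0) {s : ℝ} (hs : 0 ≤ s) {n : ℕ} (hn : s < T (n + 1) ω) (m : ℕ) :
    m ≤ stormCount T s ω ↔ T m ω ≤ s := by
  have hbdd : BddAbove {m : ℕ | T m ω ≤ s} := ⟨n, fun m hm => by
    by_contra! hlt
    exact absurd (hn.trans_le (hT hlt)) (not_lt.2 hm)⟩
  refine ⟨fun h => (hT h).trans (Nat.sSup_mem (s := {m : ℕ | T m ω ≤ s}) ⟨0, ?_⟩ hbdd),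
    fun h => le_csSup hbdd h⟩
  simpa [h0] using hs

theorem stormCount_eq {T : ℕ → Ω → ℝ} {ω : Ω} (hT : Monotone fun n => T n ω)
    (h0 : T 0 ω = 0) {s : ℝ} (hs : 0 ≤ s) {n : ℕ} (hn : T n ω ≤ s) (hn' : s < T (n + 1) ω) :
    stormCount T s ω = n := by
  refine le_antisymm ?_ ((le_stormCount_iff hT h0 hs hn' n).2 hn)
  by_contra! hlt
  exact absurd ((le_stormCount_iff hT h0 hs hn' (n + 1)).1 hlt) (not_le.2 hn')

theorem Watershed.stormJump_eq_smul (W : Watershed Γ) (p : ℝ) :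
    W.stormJump p = p • W.stormJump 1 := by
  ext i
  rcases i with e | e
  · simp [Watershed.stormJump]
  · simp [Watershed.stormJump]; ring

/-- The part of the state at time `t` that is due to the storms up to that time. -/
noncomputable def stormResponse (W : Watershed Γ) (T P : ℕ → Ω → ℝ) (t : ℝ) (ω : Ω) :
    FlowState Γ :=
  ∑ m ∈ Finset.Icc 1 (stormCount T t ω),
    P m ω • (W.flowMatrix (t - T m ω)).mulVec (W.stormJump 1)

theorem stormResponse_root (W : Watershed Γ) (T P : ℕ → Ω → ℝ) (t : ℝ) (ω : Ω) :
    stormResponse W T P t ω (Sum.inl W.root) =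
      ∑ m ∈ Finset.Icc 1 (stormCount T t ω), W.impulse (t - T m ω) * P m ω := by
  simp [stormResponse, Watershed.impulse, Finset.sum_apply, mul_comm]

/-- Variation of constants for the flow equations. -/
theorem flow_eq_of_integral_eq (W : Watershed Γ) {T P : ℕ → Ω → ℝ} {ω : Ω}
    (hT : Monotone fun n => T n ω) (h0 : T 0 ω = 0) (x : FlowState Γ) (X : ℝ → FlowState Γ)
    (hX : ∀ t : ℝ, 0 ≤ t → IntervalIntegrable (fun s => W.driftMatrix.mulVec (X s)) volume 0 t ∧
      X t = x + (∫ s in (0 : ℝ)..t, W.driftMatrix.mulVec (X s)) + drivingProcess W T P t ω)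
    {t : ℝ} (ht : 0 ≤ t) {n : ℕ} (hn : t < T (n + 1) ω) :
    X t = (W.flowMatrix t).mulVec x + stormResponse W T P t ω := by
  have hpos : ∀ m, 0 ≤ T m ω := fun m => h0 ▸ hT (Nat.zero_le m)
  have h := eq_of_eq_integral_add_jumps W.driftMatrix x X (Finset.Icc 1 (stormCount T t ω))
    (fun m => T m ω) (fun m => W.stormJump (P m ω)) (fun m _ => hpos m) ht (hX t ht).1
    fun s hs => by
      rw [(hX s hs.1).2, drivingProcess, ← Finset.sum_filter]
      congr 1
      refine Finset.sum_congr ?_ fun _ _ => rfl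
      ext m
      rw [Finset.mem_filter, Finset.mem_Icc, Finset.mem_Icc,
        le_stormCount_iff hT h0 hs.1 (hs.2.trans_lt hn), le_stormCount_iff hT h0 ht hn]
      exact ⟨fun h => ⟨⟨h.1, h.2.trans hs.2⟩, h.2⟩, fun h => ⟨h.1.1, h.2⟩⟩
  rw [h, stormResponse, Watershed.flowMatrix]
  congr 1
  refine Finset.sum_congr rfl fun m hm => ?_
  rw [jumpResponse, if_pos ((le_stormCount_iff hT h0 ht hn m).1 (Finset.mem_Icc.1 hm).2),
    W.stormJump_eq_smul (P m ω), Matrix.mulVec_smul, Watershed.flowMatrix]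

/-- For k ≥ 1 the count is at least k exactly when the set of m with T_m ≤ t is bounded and contains
some m ≥ k. Boundedness must be stated since an unbounded set has supremum 0; monotone storm times
are not needed. -/
theorem measurable_stormCount [MeasurableSpace Ω] {T : ℕ → Ω → ℝ} (hT : ∀ n, Measurable (T n))
    (t : ℝ) : Measurable (stormCount T t) := by
  have hset : ∀ n, MeasurableSet {ω | T n ω ≤ t} := fun n =>
    measurableSet_le (hT n) measurable_const
  refine measurable_of_Ici fun k => ?_
  rcases Nat.eq_zero_or_pos k with rfl | hk
  · convert MeasurableSet.univ
    ext; simp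
  have : stormCount T t ⁻¹' Set.Ici k =
      (⋃ n, ⋂ m ∈ Set.Ioi n, {ω | T m ω ≤ t}ᶜ) ∩ ⋃ m ∈ Set.Ici k, {ω | T m ω ≤ t} := by
    ext ω
    simp only [Set.mem_preimage, Set.mem_Ici, Set.mem_inter_iff, Set.mem_iUnion, Set.mem_iInter,
      Set.mem_compl_iff, Set.mem_ofPred_eq, Set.mem_Ioi, exists_prop]
    constructor
    · intro h
      have hb : BddAbove {m : ℕ | T m ω ≤ t} := by
        by_contra hb
        rw [stormCount, Nat.sSup_of_not_bddAbove hb] at h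
        omega
      have hne : {m : ℕ | T m ω ≤ t}.Nonempty := by
        by_contra hne
        rw [Set.not_nonempty_iff_eq_empty] at hne
        rw [stormCount, hne, csSup_empty] at h
        exact absurd h (by simpa using hk.ne')
      obtain ⟨n, hn⟩ := hb
      exact ⟨⟨n, fun m hm hle => absurd (hn hle) (not_le.2 hm)⟩, _, h, Nat.sSup_mem hne ⟨n, hn⟩⟩
    · rintro ⟨⟨n, hn⟩, m, hm, hle⟩
      exact hm.trans (le_csSup ⟨n, fun j hj => not_lt.1 fun hlt => hn j hlt hj⟩ hle)
  rw [this]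
  exact (MeasurableSet.iUnion fun n => MeasurableSet.biInter (Set.to_countable _)
    fun m _ => (hset m).compl).inter (MeasurableSet.biUnion (Set.to_countable _) fun m _ => hset m)

theorem measurable_stormResponse [MeasurableSpace Ω] (W : Watershed Γ) {T P : ℕ → Ω → ℝ}
    (hT : ∀ n, Measurable (T n)) (hP : ∀ n, 1 ≤ n → Measurable (P n)) (t : ℝ) :
    Measurable (stormResponse W T P t) := by
  -- The number of storms is first made a free variable of a countable type, and the random count is
  -- substituted at the end.
  have h : Measurable fun p : ℕ × Ω => ∑ m ∈ Finset.Icc 1 p.1,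
      P m p.2 • (W.flowMatrix (t - T m p.2)).mulVec (W.stormJump 1) := by
    refine measurable_from_prod_countable_right fun n => ?_
    change Measurable fun ω : Ω => ∑ m ∈ Finset.Icc 1 n,
      P m ω • (W.flowMatrix (t - T m ω)).mulVec (W.stormJump 1)
    refine Finset.measurable_fun_sum (M := FlowState Γ) _ fun m hm => ?_
    refine (hP m (Finset.mem_Icc.1 hm).1).smul ?_
    have hc : Continuous fun s => (W.flowMatrix s).mulVec (W.stormJump 1) :=
      continuous_iff_continuousAt.2 fun s =>
        (hasDerivAt_exp_smul_mulVec W.driftMatrix (W.stormJump 1) s).continuousAt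
    exact hc.measurable.comp (measurable_const.sub (hT m))
  exact h.comp ((measurable_stormCount hT t).prodMk measurable_id)

end Storms

/-! ### The Laplace functional of the marked Poisson process -/

section PoissonLaplace

variable {Ω : Type*} [MeasurableSpace Ω] {μ : Measure Ω} {lam : ℝ}
  {T P : ℕ → Ω → ℝ}

/-- The product `∏_{m = 1}^n k(T_m, P_m)`. -/
noncomputable def stormProd (T P : ℕ → Ω → ℝ) (k : ℝ × ℝ → ℝ≥0∞) (n : ℕ) (ω : Ω) : ℝ≥0∞ :=
  ∏ m ∈ Finset.range n, k (T (m + 1) ω, P (m + 1) ω)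

namespace IsUniformRainfall

theorem measurable_family (h : IsUniformRainfall μ lam T P) (i : ℕ ⊕ ℕ) :
    Measurable (Sum.elim (fun (n : ℕ) ω => T (n + 1) ω - T n ω) (fun (n : ℕ) => P (n + 1)) i) := by
  rcases i with n | n
  · exact (h.measurable_time (n + 1)).sub (h.measurable_time n)
  · exact h.measurable_depth (n + 1) (by omega)

theorem measurable_stormProd (h : IsUniformRainfall μ lam T P) {k : ℝ × ℝ → ℝ≥0∞}
    (hk : Measurable k) (n : ℕ) : Measurable (stormProd T P k n) :=
  Finset.measurable_fun_prod _ fun m _ => hk.comp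
    ((h.measurable_time (m + 1)).prodMk (h.measurable_depth (m + 1) (by omega)))

theorem measurableSet_stormCount (h : IsUniformRainfall μ lam T P) (t : ℝ) (n : ℕ) :
    MeasurableSet {ω | T n ω ≤ t ∧ t < T (n + 1) ω} :=
  (measurableSet_le (h.measurable_time n) measurable_const).inter
    (measurableSet_lt measurable_const (h.measurable_time (n + 1)))

/-- The first `n` storms are independent of the next waiting time and the next depth. -/
theorem indepFun_past (h : IsUniformRainfall μ lam T P) {k : ℝ × ℝ → ℝ≥0∞}
    (hk : Measurable k) (n : ℕ) :
    IndepFun (fun ω => (stormProd T P k n ω, T n ω))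
      (fun ω => (T (n + 1) ω - T n ω, P (n + 1) ω)) μ := by
  set f : ℕ ⊕ ℕ → Ω → ℝ :=
    Sum.elim (fun (n : ℕ) ω => T (n + 1) ω - T n ω) (fun (n : ℕ) => P (n + 1)) with hf
  -- The past consists of the first n waiting times and the first n depths. `T j`, j ≤ n, is a sum
  -- of such waiting times, hence measurable with respect to the past.
  set past : ℕ → Set (ℕ ⊕ ℕ) := fun n => {i | Sum.elim (· < n) (· < n) i} with hpast
  set next : Set (ℕ ⊕ ℕ) := {Sum.inl n, Sum.inr n} with hnext
  set m : ℕ ⊕ ℕ → MeasurableSpace Ω := fun i => MeasurableSpace.comap (f i) inferInstance with hm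
  have hdisj : Disjoint (past n) next := by
    rw [Set.disjoint_left]
    rintro (i | i) hi hi' <;> simp [hpast, hnext] at hi hi' <;> omega
  have hindep : Indep (⨆ i ∈ past n, m i) (⨆ i ∈ next, m i) μ :=
    indep_iSup_of_disjoint (fun i => (h.measurable_family i).comap_le) h.indep hdisj
  have hmem : ∀ {S : Set (ℕ ⊕ ℕ)} {i : ℕ ⊕ ℕ}, i ∈ S →
      Measurable[⨆ i ∈ S, m i] (f i) := fun {S i} hi =>
    Measurable.mono (comap_measurable (f i)) (le_iSup₂_of_le i hi le_rfl) le_rfl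
  have hT : ∀ j, j ≤ n → Measurable[⨆ i ∈ past n, m i] (T j) := by
    intro j
    induction j with
    | zero =>
      intro _
      rw [show T 0 = fun _ => 0 from funext h.time_zero]
      exact measurable_const
    | succ j ih =>
      intro hj
      have h1 : Measurable[⨆ i ∈ past n, m i] (f (Sum.inl j)) :=
        hmem (by simp only [hpast]; exact hj)
      have h2 := (ih (by omega)).add h1
      convert h2 using 1
      ext ω
      simp [hf]
  have hP : ∀ j, j < n → Measurable[⨆ i ∈ past n, m i] (P (j + 1)) := fun j hj =>
    hmem (i := Sum.inr j) (by simp only [hpast]; exact hj)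
  have hpastm : Measurable[⨆ i ∈ past n, m i] (fun ω => (stormProd T P k n ω, T n ω)) := by
    refine Measurable.prodMk ?_ (hT n le_rfl)
    refine Finset.measurable_fun_prod _ fun j hj => hk.comp ?_
    rw [Finset.mem_range] at hj
    exact (hT (j + 1) hj).prodMk (hP j hj)
  have hnextm : Measurable[⨆ i ∈ next, m i] (fun ω => (T (n + 1) ω - T n ω, P (n + 1) ω)) :=
    Measurable.prodMk (hmem (i := Sum.inl n) (by simp [hnext]))
      (hmem (i := Sum.inr n) (by simp [hnext]))
  exact (IndepFun_iff_Indep _ _ _).2 (indep_of_indep_of_le_left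
    (indep_of_indep_of_le_right hindep hnextm.comap_le) hpastm.comap_le)

variable [IsProbabilityMeasure μ]

theorem map_next (h : IsUniformRainfall μ lam T P) (n : ℕ) :
    μ.map (fun ω => (T (n + 1) ω - T n ω, P (n + 1) ω)) = (expMeasure lam).prod (μ.map (P 1)) := by
  have hi := h.indep.indepFun (i := Sum.inl n) (j := Sum.inr n) (by simp)
  have := (indepFun_iff_map_prod_eq_prod_map_map
    (h.measurable_family (Sum.inl n)).aemeasurable
    (h.measurable_family (Sum.inr n)).aemeasurable).1 hi
  simp only [Sum.elim_inl, Sum.elim_inr] at this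
  rw [this, h.waiting_law n, h.depth_law (n + 1) (by omega)]

/-- By independence, the next waiting time and depth can be integrated out with the first n storms
frozen. -/
theorem lintegral_past_next (h : IsUniformRainfall μ lam T P) (hlam : 0 < lam)
    {k : ℝ × ℝ → ℝ≥0∞} (hk : Measurable k) (n : ℕ) {F : (ℝ≥0∞ × ℝ) × (ℝ × ℝ) → ℝ≥0∞}
    (hF : Measurable F) :
    ∫⁻ ω, F ((stormProd T P k n ω, T n ω), (T (n + 1) ω - T n ω, P (n + 1) ω)) ∂μ =
      ∫⁻ ω, ∫⁻ w, ∫⁻ p, F ((stormProd T P k n ω, T n ω), (w, p)) ∂(μ.map (P 1))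
        ∂(expMeasure lam) ∂μ := by
  have := isProbabilityMeasure_expMeasure hlam
  have hP := h.measurable_depth 1 le_rfl
  have : IsProbabilityMeasure (μ.map (P 1)) := Measure.isProbabilityMeasure_map hP.aemeasurable
  have hm1 : Measurable (fun ω => (stormProd T P k n ω, T n ω)) :=
    (h.measurable_stormProd hk n).prodMk (h.measurable_time n)
  have hm2 : Measurable (fun ω => (T (n + 1) ω - T n ω, P (n + 1) ω)) :=
    (h.measurable_family (Sum.inl n)).prodMk (h.measurable_family (Sum.inr n))
  have hmap := (indepFun_iff_map_prod_eq_prod_map_map hm1.aemeasurable hm2.aemeasurable).1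
    (h.indepFun_past hk n)
  rw [h.map_next n] at hmap
  rw [← lintegral_map (f := F) hF (hm1.prodMk hm2), hmap, lintegral_prod _ hF.aemeasurable,
    lintegral_map hF.lintegral_prod_right' hm1]
  refine lintegral_congr fun ω => ?_
  rw [lintegral_prod]
  exact (hF.comp (measurable_const.prodMk measurable_id)).aemeasurable

/-- The transition operator of the storm times, weighted by `ρ`. -/
noncomputable def _root_.stormOperator (lam : ℝ) (ρ f : ℝ → ℝ≥0∞) (x : ℝ) : ℝ≥0∞ :=
  ∫⁻ w, ρ (x + w) * f (x + w) ∂(expMeasure lam)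

theorem _root_.measurable_stormOperator {lam : ℝ} (hlam : 0 < lam) {ρ f : ℝ → ℝ≥0∞}
    (hρ : Measurable ρ) (hf : Measurable f) : Measurable (stormOperator lam ρ f) := by
  have := isProbabilityMeasure_expMeasure hlam
  have h : Measurable fun p : ℝ × ℝ => ρ (p.1 + p.2) * f (p.1 + p.2) := by fun_prop
  exact h.lintegral_prod_right'

/-- Averaging over the depth of the last storm replaces k by its mean ρ, and averaging over the last
waiting time applies `stormOperator`. Iteration reduces the product over all storms to powers of
this operator at `T 0 = 0`. -/
theorem lintegral_stormProd_succ (h : IsUniformRainfall μ lam T P) (hlam : 0 < lam)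
    {k : ℝ × ℝ → ℝ≥0∞} (hk : Measurable k) (n : ℕ) {f : ℝ → ℝ≥0∞} (hf : Measurable f) :
    ∫⁻ ω, stormProd T P k (n + 1) ω * f (T (n + 1) ω) ∂μ =
      ∫⁻ ω, stormProd T P k n ω *
        stormOperator lam (fun s => ∫⁻ p, k (s, p) ∂(μ.map (P 1))) f (T n ω) ∂μ := by
  have hF : Measurable fun q : (ℝ≥0∞ × ℝ) × (ℝ × ℝ) =>
      q.1.1 * (k (q.1.2 + q.2.1, q.2.2) * f (q.1.2 + q.2.1)) := by fun_prop
  have hstep := h.lintegral_past_next hlam hk n hF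
  have hprob : IsProbabilityMeasure (μ.map (P 1)) :=
    Measure.isProbabilityMeasure_map (h.measurable_depth 1 le_rfl).aemeasurable
  have := isProbabilityMeasure_expMeasure hlam
  simp only [add_sub_cancel] at hstep
  have hleft : ∀ ω, stormProd T P k (n + 1) ω * f (T (n + 1) ω) =
      stormProd T P k n ω * (k (T (n + 1) ω, P (n + 1) ω) * f (T (n + 1) ω)) := fun ω => by
    rw [stormProd, Finset.prod_range_succ, mul_assoc, stormProd]
  simp only [hleft]
  rw [hstep]
  refine lintegral_congr fun ω => ?_
  have hρ : Measurable fun s => ∫⁻ p, k (s, p) ∂(μ.map (P 1)) := hk.lintegral_prod_right'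
  rw [stormOperator, ← lintegral_const_mul _ (by fun_prop)]
  refine lintegral_congr fun w => ?_
  rw [lintegral_const_mul _ (by fun_prop), lintegral_mul_const _ (by fun_prop)]

theorem lintegral_stormProd (h : IsUniformRainfall μ lam T P) (hlam : 0 < lam)
    {k : ℝ × ℝ → ℝ≥0∞} (hk : Measurable k) (n : ℕ) {f : ℝ → ℝ≥0∞} (hf : Measurable f) :
    ∫⁻ ω, stormProd T P k n ω * f (T n ω) ∂μ =
      (stormOperator lam (fun s => ∫⁻ p, k (s, p) ∂(μ.map (P 1))))^[n] f 0 := by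
  have hprob : IsProbabilityMeasure (μ.map (P 1)) :=
    Measure.isProbabilityMeasure_map (h.measurable_depth 1 le_rfl).aemeasurable
  induction n generalizing f with
  | zero => simp [stormProd, h.time_zero]
  | succ n ih =>
    rw [h.lintegral_stormProd_succ hlam hk n hf,
      ih (measurable_stormOperator hlam hk.lintegral_prod_right' hf), Function.iterate_succ_apply]

end IsUniformRainfall

theorem lintegral_expMeasure {lam : ℝ} {f : ℝ → ℝ≥0∞} (hf : Measurable f) :
    ∫⁻ w, f w ∂(expMeasure lam) =
      ∫⁻ w in Set.Ici 0, ENNReal.ofReal (lam * Real.exp (-(lam * w))) * f w := by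
  have hm : Measurable (exponentialPDF lam) :=
    (measurable_exponentialPDFReal lam).ennreal_ofReal
  change ∫⁻ w, f w ∂(volume.withDensity (exponentialPDF lam)) = _
  rw [lintegral_withDensity_eq_lintegral_mul _ hm hf, ← lintegral_indicator measurableSet_Ici]
  refine lintegral_congr fun w => ?_
  by_cases hw : 0 ≤ w
  · rw [Set.indicator_of_mem (show w ∈ Set.Ici (0 : ℝ) from hw), Pi.mul_apply,
      exponentialPDF_of_nonneg hw]
  · rw [Set.indicator_of_notMem (show w ∉ Set.Ici (0 : ℝ) from hw), Pi.mul_apply,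
      exponentialPDF_of_neg (not_le.1 hw), zero_mul]

theorem expMeasure_Ioi {lam : ℝ} (hlam : 0 < lam) {x : ℝ} (hx : 0 ≤ x) :
    expMeasure lam (Set.Ioi x) = ENNReal.ofReal (Real.exp (-(lam * x))) := by
  have := isProbabilityMeasure_expMeasure hlam
  rw [← Set.compl_Iic, prob_compl_eq_one_sub measurableSet_Iic, ← ofReal_cdf,
    cdf_expMeasure_eq hlam, if_pos hx, ← ENNReal.ofReal_one, ← ENNReal.ofReal_sub]
  · simp
  · rw [sub_nonneg, Real.exp_le_one_iff]
    have := mul_nonneg hlam.le hx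
    linarith

theorem expMeasure_Iio_zero {lam : ℝ} : expMeasure lam (Set.Iio 0) = 0 := by
  have h := lintegral_expMeasure (lam := lam) (f := (Set.Iio (0 : ℝ)).indicator 1)
    (measurable_one.indicator measurableSet_Iio)
  rw [lintegral_indicator_one measurableSet_Iio] at h
  have hm : Measurable ((Set.Iio (0 : ℝ)).indicator (1 : ℝ → ℝ≥0∞)) :=
    measurable_one.indicator measurableSet_Iio
  rw [h, setLIntegral_eq_zero_iff measurableSet_Ici (by fun_prop)]
  refine Filter.Eventually.of_forall fun w hw => ?_
  rw [Set.indicator_of_notMem (by simpa using hw), mul_zero]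

/-- The function `e^(-λ (t - x)) (λ ∫ₓᵗ ρ)ⁿ / n!` on `x ≤ t`. -/
noncomputable def stormWeight (lam t : ℝ) (ρ : ℝ → ℝ) (n : ℕ) (x : ℝ) : ℝ≥0∞ :=
  (Set.Iic t).indicator (fun x => ENNReal.ofReal (Real.exp (-(lam * (t - x))) *
    ((lam * ∫ s in x..t, ρ s) ^ n / n.factorial))) x

theorem continuous_integral_left {ρ : ℝ → ℝ} (hρ : Continuous ρ) (t : ℝ) :
    Continuous fun x => ∫ s in x..t, ρ s := by
  simp only [intervalIntegral.integral_symm t]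
  exact (intervalIntegral.continuous_primitive (fun a b => hρ.intervalIntegrable a b) t).neg

theorem measurable_stormWeight (lam t : ℝ) {ρ : ℝ → ℝ} (hρ : Continuous ρ) (n : ℕ) :
    Measurable (stormWeight lam t ρ n) := by
  have := (continuous_integral_left hρ t).measurable
  exact Measurable.indicator (by fun_prop) measurableSet_Iic

/-- The exponentials of the two waiting periods merge into e^(-λ (t - x)). With R(y) = ∫ ρ over [y,
t], what remains is λ ρ (λ R)ⁿ / n!, minus the derivative of (λ R)^(n+1) / (n+1)!. The case n = 0 of
the weight is the probability of no further storm up to t. -/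
theorem stormOperator_stormWeight {lam : ℝ} (hlam : 0 < lam) (t : ℝ) {ρ : ℝ → ℝ}
    (hρ : Continuous ρ) (hρ0 : ∀ s, 0 ≤ ρ s) (n : ℕ) :
    stormOperator lam (fun s => ENNReal.ofReal (ρ s)) (stormWeight lam t ρ n) =
      stormWeight lam t ρ (n + 1) := by
  ext x
  have hw := measurable_stormWeight lam t hρ n
  have hρm := hρ.measurable
  rw [stormOperator, lintegral_expMeasure (by fun_prop)]
  by_cases hx : x ≤ t
  · have hR0 : ∀ y, y ≤ t → 0 ≤ ∫ s in y..t, ρ s := fun y hy =>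
      intervalIntegral.integral_nonneg hy fun s _ => hρ0 s
    set G : ℝ → ℝ := fun w => Real.exp (-(lam * (t - x))) *
      (lam * ρ (x + w) * ((lam * ∫ s in (x + w)..t, ρ s) ^ n / n.factorial)) with hG
    have hGc : Continuous G := by
      have h1 := (continuous_integral_left hρ t).comp
          (continuous_const.add continuous_id : Continuous fun w => x + w)
      simp only [Function.comp_def] at h1
      have h2 := hρ.comp (continuous_const.add continuous_id : Continuous fun w => x + w)
      simp only [Function.comp_def] at h2
      fun_prop
    have hpt : ∀ w ∈ Set.Ici (0 : ℝ), ENNReal.ofReal (lam * Real.exp (-(lam * w))) *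
        (ENNReal.ofReal (ρ (x + w)) * stormWeight lam t ρ n (x + w)) =
        (Set.Icc 0 (t - x)).indicator (fun w => ENNReal.ofReal (G w)) w := by
      intro w hw
      by_cases hwt : x + w ≤ t
      · have hmem : w ∈ Set.Icc 0 (t - x) := ⟨hw, by linarith⟩
        rw [Set.indicator_of_mem hmem, stormWeight,
          Set.indicator_of_mem (show x + w ∈ Set.Iic t from hwt), ← ENNReal.ofReal_mul (hρ0 _),
          ← ENNReal.ofReal_mul (by positivity)]
        congr 1
        have : Real.exp (-(lam * (t - x))) =
            Real.exp (-(lam * w)) * Real.exp (-(lam * (t - (x + w)))) := by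
          rw [← Real.exp_add]; ring_nf
        rw [hG]
        simp only [this]
        ring
      · rw [Set.indicator_of_notMem (fun h => hwt (by linarith [h.2])), stormWeight,
          Set.indicator_of_notMem (show x + w ∉ Set.Iic t from hwt), mul_zero, mul_zero]
    rw [setLIntegral_congr_fun measurableSet_Ici hpt, setLIntegral_indicator measurableSet_Icc,
      Set.inter_eq_left.2 Set.Icc_subset_Ici_self, ← ofReal_integral_eq_lintegral_ofReal
        (hGc.integrableOn_Icc) ((ae_restrict_mem measurableSet_Icc).mono fun w hw => ?_)]
    · rw [stormWeight, Set.indicator_of_mem (show x ∈ Set.Iic t from hx),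
        integral_Icc_eq_integral_Ioc, ← intervalIntegral.integral_of_le (by linarith), hG,
        intervalIntegral.integral_const_mul]
      congr 2
      have hder : ∀ w, HasDerivAt (fun w => -((lam * ∫ s in (x + w)..t, ρ s) ^ (n + 1) /
          (n + 1).factorial)) (lam * ρ (x + w) * ((lam * ∫ s in (x + w)..t, ρ s) ^ n /
          n.factorial)) w := by
        intro w
        have h1 : HasDerivAt (fun y => ∫ s in y..t, ρ s) (-ρ (x + w)) (x + w) :=
          intervalIntegral.integral_hasDerivAt_left (hρ.intervalIntegrable _ _)
            (hρ.stronglyMeasurableAtFilter _ _) hρ.continuousAt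
        have h2 : HasDerivAt (fun w => ∫ s in (x + w)..t, ρ s) (-ρ (x + w)) w := by
          simpa using h1.comp_const_add x w
        refine (((h2.const_mul lam).pow (n + 1)).div_const _).neg.congr_deriv ?_
        rw [Nat.factorial_succ]
        have hn : (n.factorial : ℝ) ≠ 0 := by exact_mod_cast n.factorial_ne_zero
        have hn' : ((n : ℝ) + 1) ≠ 0 := by positivity
        push_cast
        field_simp
      have hc : Continuous fun w => lam * ρ (x + w) * ((lam * ∫ s in (x + w)..t, ρ s) ^ n /
          n.factorial) := by
        have h1 := (continuous_integral_left hρ t).comp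
          (continuous_const.add continuous_id : Continuous fun w => x + w)
        simp only [Function.comp_def] at h1
        have h2 := hρ.comp (continuous_const.add continuous_id : Continuous fun w => x + w)
        simp only [Function.comp_def] at h2
        fun_prop
      rw [intervalIntegral.integral_eq_sub_of_hasDerivAt (fun w _ => hder w)
        (hc.intervalIntegrable _ _)]
      simp
    · have := hR0 (x + w) (by linarith [hw.2])
      have := hρ0 (x + w)
      simp only [hG]
      positivity
  · rw [stormWeight, Set.indicator_of_notMem (show x ∉ Set.Iic t from hx)]
    rw [setLIntegral_eq_zero_iff measurableSet_Ici (by fun_prop)]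
    refine Filter.Eventually.of_forall fun w (hw : 0 ≤ w) => ?_
    rw [stormWeight, Set.indicator_of_notMem
      (show x + w ∉ Set.Iic t from fun h => hx (by have : x + w ≤ t := h; linarith)),
      mul_zero, mul_zero]

theorem iterate_stormOperator {lam : ℝ} (hlam : 0 < lam) (t : ℝ) {ρ : ℝ → ℝ}
    (hρ : Continuous ρ) (hρ0 : ∀ s, 0 ≤ ρ s) (n : ℕ) :
    (stormOperator lam (fun s => ENNReal.ofReal (ρ s)))^[n] (stormWeight lam t ρ 0) =
      stormWeight lam t ρ n := by
  induction n with
  | zero => rfl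
  | succ n ih => rw [Function.iterate_succ_apply', ih, stormOperator_stormWeight hlam t hρ hρ0]

namespace IsUniformRainfall

theorem ae_depth_pos (h : IsUniformRainfall μ lam T P) : ∀ᵐ p ∂(μ.map (P 1)), 0 < p := by
  rw [ae_map_iff (h.measurable_depth 1 le_rfl).aemeasurable measurableSet_Ioi]
  exact h.depth_pos 1 le_rfl

theorem ae_monotone (h : IsUniformRainfall μ lam T P) :
    ∀ᵐ ω ∂μ, Monotone fun n => T n ω := by
  have hstep : ∀ n, ∀ᵐ ω ∂μ, T n ω ≤ T (n + 1) ω := by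
    intro n
    have h0 : ∀ᵐ w ∂(μ.map fun ω => T (n + 1) ω - T n ω), 0 ≤ w := by
      rw [h.waiting_law n, ae_iff]
      simp only [not_le]
      exact expMeasure_Iio_zero
    filter_upwards [ae_of_ae_map (h.measurable_family (Sum.inl n)).aemeasurable h0] with ω hω
    exact sub_nonneg.1 hω
  filter_upwards [ae_all_iff.2 hstep] with ω hω
  exact monotone_nat_of_le_succ hω

variable [IsProbabilityMeasure μ]

/-- The contribution of the event `N(t) = n` to the Laplace functional of the storms. -/
theorem lintegral_stormProd_indicator (h : IsUniformRainfall μ lam T P) (hlam : 0 < lam)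
    {k : ℝ × ℝ → ℝ≥0∞} (hk : Measurable k) {ρ : ℝ → ℝ} (hρ : Continuous ρ) (hρ0 : ∀ s, 0 ≤ ρ s)
    (hkρ : ∀ s, ∫⁻ p, k (s, p) ∂(μ.map (P 1)) = ENNReal.ofReal (ρ s)) {t : ℝ} (ht : 0 ≤ t)
    (n : ℕ) :
    ∫⁻ ω, {ω | T n ω ≤ t ∧ t < T (n + 1) ω}.indicator (stormProd T P k n) ω ∂μ =
      ENNReal.ofReal (Real.exp (-(lam * t)) *
        ((lam * ∫ s in (0 : ℝ)..t, ρ s) ^ n / n.factorial)) := by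
  have hprob : IsProbabilityMeasure (μ.map (P 1)) :=
    Measure.isProbabilityMeasure_map (h.measurable_depth 1 le_rfl).aemeasurable
  -- That exactly n storms occur up to t depends only on `T n` and the next waiting time.
  -- Integrating the latter out leaves e^(-λ (t - T_n)) on T_n ≤ t, which is `stormWeight` with
  -- exponent 0.
  set S : Set ((ℝ≥0∞ × ℝ) × (ℝ × ℝ)) := {q | q.1.2 ≤ t ∧ t < q.1.2 + q.2.1} with hS
  have hSm : MeasurableSet S := by
    rw [hS]
    measurability
  have hF : Measurable (S.indicator fun q => q.1.1) := Measurable.indicator (by fun_prop) hSm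
  have hstep := h.lintegral_past_next hlam hk n hF
  have hweight : ∫⁻ ω, stormProd T P k n ω * stormWeight lam t ρ 0 (T n ω) ∂μ =
      stormWeight lam t ρ n 0 := by
    rw [h.lintegral_stormProd hlam hk n (measurable_stormWeight lam t hρ 0)]
    simp only [hkρ]
    rw [iterate_stormOperator hlam t hρ hρ0]
  calc _ = _ := by
        refine Eq.trans (lintegral_congr fun ω => ?_) hstep
        by_cases hω : T n ω ≤ t ∧ t < T (n + 1) ω
        · rw [Set.indicator_of_mem (by exact hω), Set.indicator_of_mem]
          simpa [hS] using hω
        · rw [Set.indicator_of_notMem (by exact hω), Set.indicator_of_notMem]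
          simpa [hS] using hω
    _ = ∫⁻ ω, stormProd T P k n ω * stormWeight lam t ρ 0 (T n ω) ∂μ := by
        refine lintegral_congr fun ω => ?_
        by_cases hx : T n ω ≤ t
        · have hin : ∀ w p, S.indicator (fun q => q.1.1) ((stormProd T P k n ω, T n ω), (w, p)) =
              (Set.Ioi (t - T n ω)).indicator (fun _ => stormProd T P k n ω) w := by
            intro w p
            by_cases hw : t - T n ω < w
            · rw [Set.indicator_of_mem (show w ∈ Set.Ioi (t - T n ω) from hw),
                Set.indicator_of_mem]
              exact ⟨hx, by simp only; linarith⟩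
            · rw [Set.indicator_of_notMem (show w ∉ Set.Ioi (t - T n ω) from hw),
                Set.indicator_of_notMem]
              rintro ⟨_, h2⟩
              simp only at h2
              exact hw (by linarith)
          simp only [hin, lintegral_const, measure_univ, mul_one]
          rw [lintegral_indicator measurableSet_Ioi, setLIntegral_const,
            expMeasure_Ioi hlam (by linarith), stormWeight,
            Set.indicator_of_mem (show T n ω ∈ Set.Iic t from hx)]
          simp
        · have hin : ∀ w p, S.indicator (fun q => q.1.1)
              ((stormProd T P k n ω, T n ω), (w, p)) = 0 := fun w p =>
            Set.indicator_of_notMem (fun hq => hx hq.1) _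
          simp only [hin, lintegral_zero]
          rw [stormWeight, Set.indicator_of_notMem (show T n ω ∉ Set.Iic t from hx), mul_zero]
    _ = _ := by
        rw [hweight, stormWeight, Set.indicator_of_mem (show (0 : ℝ) ∈ Set.Iic t from ht), sub_zero]

theorem _root_.tsum_ofReal_exp_mul_pow {a b : ℝ} (ha : 0 ≤ a) :
    ∑' n : ℕ, ENNReal.ofReal (Real.exp (-b) * (a ^ n / n.factorial)) =
      ENNReal.ofReal (Real.exp (a - b)) := by
  have hs : HasSum (fun n : ℕ => Real.exp (-b) * (a ^ n / n.factorial))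
      (Real.exp (-b) * Real.exp a) := by
    have := NormedSpace.expSeries_div_hasSum_exp (𝔸 := ℝ) a
    rw [← Real.exp_eq_exp_ℝ] at this
    exact this.mul_left _
  rw [← ENNReal.ofReal_tsum_of_nonneg (fun n => by positivity) hs.summable, hs.tsum_eq,
    ← Real.exp_add]
  ring_nf

/-- Almost surely, only finitely many storms occur before time `t`. -/
theorem ae_exists_stormCount (h : IsUniformRainfall μ lam T P) (hlam : 0 < lam) {t : ℝ}
    (ht : 0 ≤ t) : ∀ᵐ ω ∂μ, ∃ n, T n ω ≤ t ∧ t < T (n + 1) ω := by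
  set A : ℕ → Set Ω := fun n => {ω | T n ω ≤ t ∧ t < T (n + 1) ω} with hA
  have hAm : ∀ n, MeasurableSet (A n) := fun n => h.measurableSet_stormCount t n
  -- The kernel k = 1 gives the Poisson probabilities. They sum to 1, so these almost disjoint
  -- events exhaust Ω up to a null set.
  have hmeas : ∀ n, μ (A n) =
      ENNReal.ofReal (Real.exp (-(lam * t)) * ((lam * t) ^ n / n.factorial)) := by
    intro n
    have hprob : IsProbabilityMeasure (μ.map (P 1)) :=
      Measure.isProbabilityMeasure_map (h.measurable_depth 1 le_rfl).aemeasurable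
    have := h.lintegral_stormProd_indicator hlam (k := fun _ => 1) measurable_const
      (ρ := fun _ => 1) continuous_const (fun _ => zero_le_one) (fun s => by simp) ht n
    simp only [intervalIntegral.integral_const, sub_zero, smul_eq_mul, mul_one] at this
    rw [← this, show stormProd T P (fun _ => 1) n = 1 by ext; simp [stormProd],
      lintegral_indicator_one (hAm n)]
  have hdisj : Pairwise fun i j => AEDisjoint μ (A i) (A j) := by
    have key : ∀ i j, i < j → AEDisjoint μ (A i) (A j) := by
      intro i j hij
      rw [AEDisjoint, measure_eq_zero_iff_ae_notMem]
      filter_upwards [h.ae_monotone] with ω hω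
      rintro ⟨h1, h2⟩
      exact absurd (h1.2.trans_le (hω (show i + 1 ≤ j from hij))) (not_lt.2 h2.1)
    intro i j hij
    rcases lt_or_gt_of_ne hij with hlt | hlt
    · exact key i j hlt
    · exact (key j i hlt).symm
  have hunion : μ (⋃ n, A n) = 1 := by
    rw [measure_iUnion₀ hdisj fun n => (hAm n).nullMeasurableSet]
    simp only [hmeas]
    rw [tsum_ofReal_exp_mul_pow (by positivity)]
    simp
  have := (prob_compl_eq_zero_iff (MeasurableSet.iUnion hAm)).2 hunion
  rw [← mem_ae_iff] at this
  filter_upwards [this] with ω hω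
  simpa [hA] using hω

/-- The Laplace functional of the storms up to time `t`. -/
theorem lintegral_stormProd_stormCount (h : IsUniformRainfall μ lam T P) (hlam : 0 < lam)
    {k : ℝ × ℝ → ℝ≥0∞} (hk : Measurable k) {ρ : ℝ → ℝ} (hρ : Continuous ρ) (hρ0 : ∀ s, 0 ≤ ρ s)
    (hkρ : ∀ s, ∫⁻ p, k (s, p) ∂(μ.map (P 1)) = ENNReal.ofReal (ρ s)) {t : ℝ} (ht : 0 ≤ t) :
    ∫⁻ ω, stormProd T P k (stormCount T t ω) ω ∂μ =
      ENNReal.ofReal (Real.exp (lam * (∫ s in (0 : ℝ)..t, ρ s) - lam * t)) := by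
  -- The right side is expanded in the exponential series, whose n-th term is the contribution of
  -- N(t) = n; almost surely exactly one of these events occurs.
  rw [← tsum_ofReal_exp_mul_pow (mul_nonneg hlam.le
    (intervalIntegral.integral_nonneg ht fun s _ => hρ0 s)), ← tsum_congr fun n =>
      h.lintegral_stormProd_indicator hlam hk hρ hρ0 hkρ ht n, ← lintegral_tsum fun n =>
      ((h.measurable_stormProd hk n).indicator
        (h.measurableSet_stormCount t n)).aemeasurable]
  refine lintegral_congr_ae ?_
  filter_upwards [h.ae_monotone, h.ae_exists_stormCount hlam ht] with ω hmono ⟨n, hn, hn'⟩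
  have hcount : ∀ m, T m ω ≤ t ∧ t < T (m + 1) ω → stormCount T t ω = m := fun m hm =>
    stormCount_eq hmono (h.time_zero ω) ht hm.1 hm.2
  have hne : ∀ m, m ≠ n →
      {ω | T m ω ≤ t ∧ t < T (m + 1) ω}.indicator (stormProd T P k m) ω = 0 := fun m hm =>
    Set.indicator_of_notMem (fun hmem : ω ∈ {ω | T m ω ≤ t ∧ t < T (m + 1) ω} =>
      hm ((hcount m hmem).symm.trans (hcount n ⟨hn, hn'⟩))) _
  rw [hcount n ⟨hn, hn'⟩, tsum_eq_single n hne]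
  exact (Set.indicator_of_mem (show ω ∈ {ω | T n ω ≤ t ∧ t < T (n + 1) ω} from ⟨hn, hn'⟩) _).symm

end IsUniformRainfall

end PoissonLaplace

/-! ### The Laplace transform of the stationary outlet flow -/

section StationaryLaplace

theorem measurableSet_positiveOrthant {Γ : Type*} [Fintype Γ] :
    MeasurableSet (positiveOrthant Γ) := by
  have : positiveOrthant Γ = ⋂ i, {x : FlowState Γ | 0 < x i} := by
    ext x; simp [positiveOrthant]
  rw [this]
  exact MeasurableSet.iInter fun i => measurableSet_lt measurable_const (measurable_pi_apply i)

variable {Ω : Type*} [MeasurableSpace Ω] {μ : Measure Ω} [IsProbabilityMeasure μ] {lam : ℝ}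
  {T P : ℕ → Ω → ℝ} {Γ : Type*} [Fintype Γ] [DecidableEq Γ]

/-- The Laplace transform of the outlet's response, a time `s` after a storm of random depth with
law `π`. For `s < 0` the value at `0` is used. -/
noncomputable def Watershed.responseLaplace (W : Watershed Γ) (π : Measure ℝ) (θ s : ℝ) : ℝ :=
  ∫ p, Real.exp (-(θ * (W.impulse (max s 0) * p))) ∂π

theorem Watershed.exp_neg_response_le_one (W : Watershed Γ) {θ : ℝ} (hθ : 0 ≤ θ) (s : ℝ) {p : ℝ}
    (hp : 0 < p) : Real.exp (-(θ * (W.impulse (max s 0) * p))) ≤ 1 := by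
  rw [Real.exp_le_one_iff, neg_nonpos]
  have := W.impulse_nonneg (le_max_right s 0)
  positivity

theorem Watershed.integrable_exp_neg_response (W : Watershed Γ) {π : Measure ℝ}
    [IsProbabilityMeasure π] (hπ : ∀ᵐ p ∂π, 0 < p) {θ : ℝ} (hθ : 0 ≤ θ) (s : ℝ) :
    Integrable (fun p => Real.exp (-(θ * (W.impulse (max s 0) * p)))) π := by
  refine Integrable.of_bound (by fun_prop) 1 ?_
  filter_upwards [hπ] with p hp
  rw [Real.norm_of_nonneg (Real.exp_pos _).le]
  exact W.exp_neg_response_le_one hθ s hp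

theorem Watershed.continuous_responseLaplace (W : Watershed Γ) {π : Measure ℝ}
    [IsProbabilityMeasure π] (hπ : ∀ᵐ p ∂π, 0 < p) {θ : ℝ} (hθ : 0 ≤ θ) :
    Continuous (W.responseLaplace π θ) := by
  refine continuous_of_dominated (bound := fun _ => 1) (fun s => by fun_prop) (fun s => ?_)
    (integrable_const _) (Filter.Eventually.of_forall fun p => ?_)
  · filter_upwards [hπ] with p hp
    rw [Real.norm_of_nonneg (Real.exp_pos _).le]
    exact W.exp_neg_response_le_one hθ s hp
  · have := W.continuous_impulse
    fun_prop

theorem Watershed.responseLaplace_le_one (W : Watershed Γ) {π : Measure ℝ}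
    [IsProbabilityMeasure π] (hπ : ∀ᵐ p ∂π, 0 < p) {θ : ℝ} (hθ : 0 ≤ θ) (s : ℝ) :
    W.responseLaplace π θ s ≤ 1 := by
  calc W.responseLaplace π θ s ≤ ∫ _, (1 : ℝ) ∂π :=
        integral_mono_ae (W.integrable_exp_neg_response hπ hθ s) (integrable_const _) (by
          filter_upwards [hπ] with p hp
          exact W.exp_neg_response_le_one hθ s hp)
    _ = 1 := by simp

theorem Watershed.responseLaplace_nonneg (W : Watershed Γ) (π : Measure ℝ) (θ s : ℝ) :
    0 ≤ W.responseLaplace π θ s :=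
  integral_nonneg fun _ => (Real.exp_pos _).le

theorem sum_Icc_one_eq_sum_range {M : Type*} [AddCommMonoid M] (f : ℕ → M) (n : ℕ) :
    ∑ m ∈ Finset.Icc 1 n, f m = ∑ m ∈ Finset.range n, f (m + 1) := by
  rw [Finset.range_eq_Ico, Finset.sum_Ico_add' f 0 n 1]
  rfl

namespace IsUniformRainfall

theorem isProbabilityMeasure_depth (h : IsUniformRainfall μ lam T P) :
    IsProbabilityMeasure (μ.map (P 1)) :=
  Measure.isProbabilityMeasure_map (h.measurable_depth 1 le_rfl).aemeasurable

/-- The Laplace transform of the outlet's response to the storms up to time `t`. -/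
theorem integral_exp_neg_stormResponse (h : IsUniformRainfall μ lam T P) (hlam : 0 < lam)
    (W : Watershed Γ) {θ : ℝ} (hθ : 0 ≤ θ) {t : ℝ} (ht : 0 ≤ t) :
    ∫ ω, Real.exp (-(θ * stormResponse W T P t ω (Sum.inl W.root))) ∂μ =
      Real.exp (-(lam * ∫ s in (0 : ℝ)..t, (1 - W.responseLaplace (μ.map (P 1)) θ s))) := by
  have hprob := h.isProbabilityMeasure_depth
  have hpos := h.ae_depth_pos
  have hcont := W.continuous_responseLaplace hpos hθ
  -- The truncation at 0 keeps the kernel at most 1 for positive depths at all times, also after t.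
  -- It is inactive at the storms that are counted.
  set k : ℝ × ℝ → ℝ≥0∞ := fun q =>
    ENNReal.ofReal (Real.exp (-(θ * (W.impulse (max (t - q.1) 0) * q.2)))) with hk
  have hkm : Measurable k := by
    have := W.continuous_impulse.measurable
    fun_prop
  have hlap := h.lintegral_stormProd_stormCount hlam hkm
    (ρ := fun s => W.responseLaplace (μ.map (P 1)) θ (t - s)) (by fun_prop)
    (fun s => W.responseLaplace_nonneg _ _ _) (fun s =>
      (ofReal_integral_eq_lintegral_ofReal (W.integrable_exp_neg_response hpos hθ (t - s))
        (Filter.Eventually.of_forall fun _ => (Real.exp_pos _).le)).symm) ht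
  have hae : ∀ᵐ ω ∂μ, stormProd T P k (stormCount T t ω) ω =
      ENNReal.ofReal (Real.exp (-(θ * stormResponse W T P t ω (Sum.inl W.root)))) := by
    filter_upwards [h.ae_monotone, h.ae_exists_stormCount hlam ht] with ω hmono ⟨n, _, hn⟩
    rw [stormResponse_root, stormProd, ← ENNReal.ofReal_prod_of_nonneg
      (fun _ _ => (Real.exp_pos _).le), ← Real.exp_sum, sum_Icc_one_eq_sum_range, Finset.mul_sum,
      ← Finset.sum_neg_distrib]
    congr 2
    refine Finset.sum_congr rfl fun m hm => ?_
    have hle := (le_stormCount_iff hmono (h.time_zero ω) ht hn (m + 1)).1 (Finset.mem_range.1 hm)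
    rw [max_eq_left (by linarith)]
  have hmeas := (measurable_pi_apply (Sum.inl W.root)).comp
    (measurable_stormResponse W h.measurable_time h.measurable_depth t)
  simp only [Function.comp_def] at hmeas
  rw [integral_eq_lintegral_of_nonneg_ae (Filter.Eventually.of_forall fun _ => (Real.exp_pos _).le)
    (by fun_prop), ← lintegral_congr_ae hae, hlap, ENNReal.toReal_ofReal (Real.exp_pos _).le,
    intervalIntegral.integral_comp_sub_left (fun s => W.responseLaplace (μ.map (P 1)) θ s),
    intervalIntegral.integral_sub (by simp) (hcont.intervalIntegrable _ _)]
  simp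
  ring

end IsUniformRainfall

/-- Almost surely, the flow is the deterministic flow of the initial state plus the response to
the storms. -/
theorem IsFlowProcess.ae_eq {W : Watershed Γ} {X : FlowState Γ → ℝ → Ω → FlowState Γ}
    (hX : IsFlowProcess μ W T P X) (h : IsUniformRainfall μ lam T P) (hlam : 0 < lam)
    {x : FlowState Γ} (hx : x ∈ positiveOrthant Γ) {t : ℝ} (ht : 0 ≤ t) :
    ∀ᵐ ω ∂μ, X x t ω = (W.flowMatrix t).mulVec x + stormResponse W T P t ω := by
  filter_upwards [hX x hx, h.ae_monotone, h.ae_exists_stormCount hlam ht] with ω hω hmono ⟨n, _, hn⟩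
  exact flow_eq_of_integral_eq W hmono (h.time_zero ω) x (fun s => X x s ω) hω ht hn

theorem measurable_flowMatrix_mulVec (W : Watershed Γ) (t : ℝ) :
    Measurable fun x : FlowState Γ => (W.flowMatrix t).mulVec x :=
  (continuous_const.matrix_mulVec continuous_id).measurable

/-- An invariant distribution is the law of the state at time `t` when it is the initial law. -/
theorem IsInvariantDistribution.eq_map {W : Watershed Γ}
    {X : FlowState Γ → ℝ → Ω → FlowState Γ} {g : Measure (FlowState Γ)}
    (hg : IsInvariantDistribution μ X g) (hX : IsFlowProcess μ W T P X)
    (h : IsUniformRainfall μ lam T P) (hlam : 0 < lam) {t : ℝ} (ht : 0 < t) :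
    g = (g.prod μ).map fun q => (W.flowMatrix t).mulVec q.1 + stormResponse W T P t q.2 := by
  have := hg.isProbabilityMeasure
  -- The explicit map F is jointly measurable and agrees almost surely with X for each initial
  -- state; measurability of X itself is not assumed.
  set F : FlowState Γ × Ω → FlowState Γ :=
    fun q => (W.flowMatrix t).mulVec q.1 + stormResponse W T P t q.2 with hF
  have hFm : Measurable F :=
    ((measurable_flowMatrix_mulVec W t).comp measurable_fst).add
      ((measurable_stormResponse W h.measurable_time h.measurable_depth t).comp measurable_snd)
  have hprob : IsProbabilityMeasure ((g.prod μ).map F) :=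
    Measure.isProbabilityMeasure_map hFm.aemeasurable
  -- Invariance speaks only of subsets of the orthant. Applied to the orthant itself it shows that
  -- the image law is carried there, which extends the equality to all measurable sets.
  have hsub : ∀ A, MeasurableSet A → A ⊆ positiveOrthant Γ → (g.prod μ).map F A = g A := by
    intro A hA hAsub
    rw [Measure.map_apply hFm hA, Measure.prod_apply (hFm hA), ← hg.invariant t ht A hA hAsub]
    refine lintegral_congr_ae ?_
    filter_upwards [hg.ae_mem] with x hx
    refine measure_congr ?_
    filter_upwards [hX.ae_eq h hlam hx ht.le] with ω hω
    refine propext ?_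
    change F (x, ω) ∈ A ↔ X x t ω ∈ A
    rw [hω]
  have hg1 : g (positiveOrthant Γ)ᶜ = 0 := by
    rw [← mem_ae_iff]; exact hg.ae_mem
  have hF1 : (g.prod μ).map F (positiveOrthant Γ)ᶜ = 0 := by
    rw [prob_compl_eq_zero_iff measurableSet_positiveOrthant,
      hsub _ measurableSet_positiveOrthant subset_rfl]
    exact (prob_compl_eq_zero_iff measurableSet_positiveOrthant).1 hg1
  ext A hA
  rw [← measure_inter_conull hg1, ← measure_inter_conull (μ := (g.prod μ).map F) hF1,
    hsub _ (hA.inter measurableSet_positiveOrthant) Set.inter_subset_right]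

theorem Watershed.flowMatrix_mulVec_nonneg (W : Watershed Γ) {t : ℝ} (ht : 0 ≤ t)
    {x : FlowState Γ} (hx : x ∈ positiveOrthant Γ) (i : Γ ⊕ Γ) :
    0 ≤ (W.flowMatrix t).mulVec x i :=
  Finset.sum_nonneg fun j _ => mul_nonneg (W.flowMatrix_nonneg ht i j) (le_of_lt (hx j))

theorem Watershed.tendsto_flowMatrix_apply (W : Watershed Γ) (i j : Γ ⊕ Γ) :
    Filter.Tendsto (fun t => W.flowMatrix t i j) Filter.atTop (nhds 0) := by
  obtain ⟨C, δ, _, hδ, hle⟩ := W.exists_flowMatrix_le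
  have hexp : Filter.Tendsto (fun t => C * Real.exp (-δ * t)) Filter.atTop (nhds 0) := by
    have : Filter.Tendsto (fun t => -δ * t) Filter.atTop Filter.atBot :=
      Filter.tendsto_id.const_mul_atTop_of_neg (by linarith)
    simpa using (Real.tendsto_exp_atBot.comp this).const_mul C
  refine tendsto_of_tendsto_of_tendsto_of_le_of_le' tendsto_const_nhds hexp ?_ ?_
  · filter_upwards [Filter.eventually_ge_atTop 0] with t ht using W.flowMatrix_nonneg ht i j
  · filter_upwards [Filter.eventually_ge_atTop 0] with t ht using hle t ht i j

theorem Watershed.tendsto_flowMatrix_mulVec (W : Watershed Γ) (x : FlowState Γ) (i : Γ ⊕ Γ) :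
    Filter.Tendsto (fun t => (W.flowMatrix t).mulVec x i) Filter.atTop (nhds 0) := by
  have := tendsto_finsetSum (Finset.univ : Finset (Γ ⊕ Γ)) fun j _ =>
    (W.tendsto_flowMatrix_apply i j).mul_const (x j)
  simpa [Matrix.mulVec, dotProduct] using this

/-- The Laplace transform of the stationary streamflow at the outlet. -/
theorem IsInvariantDistribution.integral_exp_neg {W : Watershed Γ}
    {X : FlowState Γ → ℝ → Ω → FlowState Γ} {g : Measure (FlowState Γ)}
    (hg : IsInvariantDistribution μ X g) (hX : IsFlowProcess μ W T P X)
    (h : IsUniformRainfall μ lam T P) (hlam : 0 < lam) {θ : ℝ} (hθ : 0 ≤ θ) :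
    IntegrableOn (fun s => 1 - W.responseLaplace (μ.map (P 1)) θ s) (Set.Ioi 0) ∧
    ∫ x, Real.exp (-(θ * x (Sum.inl W.root))) ∂g =
      Real.exp (-(lam * ∫ s in Set.Ioi (0 : ℝ), (1 - W.responseLaplace (μ.map (P 1)) θ s))) := by
  have := hg.isProbabilityMeasure
  have hprob := h.isProbabilityMeasure_depth
  have hpos := h.ae_depth_pos
  have hcont := W.continuous_responseLaplace hpos hθ
  set D : ℝ → ℝ := fun s => 1 - W.responseLaplace (μ.map (P 1)) θ s with hD
  have hDc : Continuous D := continuous_const.sub hcont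
  have hD0 : ∀ s, 0 ≤ D s := fun s => sub_nonneg.2 (W.responseLaplace_le_one hpos hθ s)
  set r : Γ ⊕ Γ := Sum.inl W.root with hr
  set L : ℝ := ∫ x, Real.exp (-(θ * x r)) ∂g with hL
  set A : ℝ → ℝ := fun t => ∫ x, Real.exp (-(θ * (W.flowMatrix t).mulVec x r)) ∂g with hA
  have hexpm : Measurable fun x : FlowState Γ => Real.exp (-(θ * x r)) := by fun_prop
  -- Initial state and storms are independent under the product measure, so the transform factors.
  have hfac : ∀ t, 0 < t → L = A t * Real.exp (-(lam * ∫ s in (0 : ℝ)..t, D s)) := by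
    intro t ht
    have hresp := measurable_stormResponse W h.measurable_time h.measurable_depth t
    have hflow := measurable_flowMatrix_mulVec W t
    rw [← h.integral_exp_neg_stormResponse hlam W hθ ht.le, hA, ← integral_prod_mul, hL]
    conv_lhs => rw [hg.eq_map hX h hlam ht]
    rw [integral_map (by fun_prop) hexpm.aestronglyMeasurable]
    refine integral_congr_ae (Filter.Eventually.of_forall fun q => ?_)
    simp only [Pi.add_apply]
    rw [← Real.exp_add, hr]
    ring_nf
  have hAlim : Filter.Tendsto A Filter.atTop (nhds 1) := by
    have := tendsto_integral_filter_of_dominated_convergence (μ := g) (l := Filter.atTop)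
      (F := fun t x => Real.exp (-(θ * (W.flowMatrix t).mulVec x r))) (f := fun _ => 1)
      (fun _ => 1) (Filter.Eventually.of_forall fun t => by
        have hflow := measurable_flowMatrix_mulVec W t
        fun_prop) ?_ (integrable_const _) ?_
    · simpa using this
    · filter_upwards [Filter.eventually_ge_atTop 0] with t ht
      filter_upwards [hg.ae_mem] with x hx
      rw [Real.norm_of_nonneg (Real.exp_pos _).le, Real.exp_le_one_iff, neg_nonpos]
      exact mul_nonneg hθ (W.flowMatrix_mulVec_nonneg ht hx r)
    · refine Filter.Eventually.of_forall fun x => ?_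
      have h1 := ((W.tendsto_flowMatrix_mulVec x r).const_mul θ).neg
      simpa [Function.comp_def] using (Real.continuous_exp.tendsto _).comp h1
  have hLpos : 0 < L := by
    refine integral_exp_pos (Integrable.of_bound hexpm.aestronglyMeasurable 1 ?_)
    filter_upwards [hg.ae_mem] with x hx
    rw [Real.norm_of_nonneg (Real.exp_pos _).le, Real.exp_le_one_iff, neg_nonpos]
    exact mul_nonneg hθ (le_of_lt (hx r))
  -- Since L > 0 and A(t) → 1, solving the factorization for the integral gives a finite limit. As D
  -- ≥ 0, the existence of g alone makes D integrable.
  have hI : Filter.Tendsto (fun t => ∫ s in (0 : ℝ)..t, D s) Filter.atTop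
      (nhds (-(Real.log L / lam))) := by
    have h1 : Filter.Tendsto (fun t => -(Real.log (L / A t) / lam)) Filter.atTop
        (nhds (-(Real.log (L / 1) / lam))) :=
      ((((tendsto_const_nhds (x := L)).div hAlim one_ne_zero).log
        (by simpa using hLpos.ne')).div_const lam).neg
    rw [div_one] at h1
    refine h1.congr' ?_
    filter_upwards [Filter.eventually_gt_atTop 0] with t ht
    have hAt : A t ≠ 0 := fun h0 => by
      have := hfac t ht
      rw [h0, zero_mul] at this
      exact hLpos.ne' this
    rw [hfac t ht, mul_div_cancel_left₀ _ hAt, Real.log_exp]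
    field_simp
  have hInt : IntegrableOn D (Set.Ioi 0) := by
    refine integrableOn_Ioi_of_intervalIntegral_norm_tendsto (-(Real.log L / lam)) 0
      (fun t => hDc.integrableOn_Ioc) Filter.tendsto_id ?_
    simpa only [id, Real.norm_of_nonneg (hD0 _)] using hI
  refine ⟨hInt, ?_⟩
  have hlim := tendsto_nhds_unique
    (intervalIntegral_tendsto_integral_Ioi 0 hInt Filter.tendsto_id) hI
  rw [hlim]
  have : -(lam * -(Real.log L / lam)) = Real.log L := by field_simp
  rw [this, Real.exp_log hLpos]

/-- The Laplace transform of the stationary streamflow at the outlet, in terms of the response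
`φ(s) p`, `s > 0`, to a storm of depth `p`. -/
theorem IsInvariantDistribution.integral_exp_neg_eq_prod {W : Watershed Γ}
    {X : FlowState Γ → ℝ → Ω → FlowState Γ} {g : Measure (FlowState Γ)}
    (hg : IsInvariantDistribution μ X g) (hX : IsFlowProcess μ W T P X)
    (h : IsUniformRainfall μ lam T P) (hlam : 0 < lam) {θ : ℝ} (hθ : 0 ≤ θ) :
    Integrable (fun q : ℝ × ℝ => 1 - Real.exp (-(θ * (W.impulse q.1 * q.2))))
      ((volume.restrict (Set.Ioi 0)).prod (μ.map (P 1))) ∧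
    ∫ x, Real.exp (-(θ * x (Sum.inl W.root))) ∂g =
      Real.exp (-(lam * ∫ q : ℝ × ℝ, (1 - Real.exp (-(θ * (W.impulse q.1 * q.2))))
        ∂((volume.restrict (Set.Ioi 0)).prod (μ.map (P 1))))) := by
  obtain ⟨hInt, heq⟩ := hg.integral_exp_neg hX h hlam hθ
  have hprob := h.isProbabilityMeasure_depth
  have hpos := h.ae_depth_pos
  have hmax : ∀ s ∈ Set.Ioi (0 : ℝ), max s 0 = s := fun s hs => max_eq_left (le_of_lt hs)
  have hinner : ∀ s ∈ Set.Ioi (0 : ℝ),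
      ∫ p, (1 - Real.exp (-(θ * (W.impulse s * p)))) ∂(μ.map (P 1)) =
        1 - W.responseLaplace (μ.map (P 1)) θ s := fun s hs => by
    have h1 := W.integrable_exp_neg_response hpos hθ s
    rw [hmax s hs] at h1
    rw [integral_sub (integrable_const _) h1, Watershed.responseLaplace, hmax s hs]
    simp
  have hm := W.continuous_impulse.measurable
  have hI : Integrable (fun q : ℝ × ℝ => 1 - Real.exp (-(θ * (W.impulse q.1 * q.2))))
      ((volume.restrict (Set.Ioi 0)).prod (μ.map (P 1))) := by
    rw [integrable_prod_iff (by fun_prop)]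
    refine ⟨?_, hInt.congr ?_⟩
    · filter_upwards [ae_restrict_mem measurableSet_Ioi] with s hs
      have h1 := W.integrable_exp_neg_response hpos hθ s
      rw [hmax s hs] at h1
      exact (integrable_const _).sub h1
    · filter_upwards [ae_restrict_mem measurableSet_Ioi] with s hs
      rw [← hinner s hs]
      refine integral_congr_ae ?_
      filter_upwards [hpos] with p hp
      have := W.exp_neg_response_le_one hθ s hp
      rw [hmax s hs] at this
      rw [Real.norm_of_nonneg (by linarith)]
  refine ⟨hI, ?_⟩
  rw [heq, integral_prod _ hI, setIntegral_congr_fun measurableSet_Ioi hinner]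

end StationaryLaplace

/-! ### Moments of a nonnegative infinitely divisible law -/

section MomentRecursion

/-- This is 1 + θx ≤ e^(θx) multiplied by e^(-θx). It transfers integrability from 1 - e^(-θZ) to Z
e^(-θZ). -/
theorem Real.mul_exp_neg_le {x θ : ℝ} (hθ : 0 < θ) :
    x * Real.exp (-(θ * x)) ≤ (1 - Real.exp (-(θ * x))) / θ := by
  rw [le_div_iff₀ hθ]
  have h1 := Real.add_one_le_exp (θ * x)
  have h2 : Real.exp (θ * x) * Real.exp (-(θ * x)) = 1 := by rw [← Real.exp_add]; simp
  nlinarith [Real.exp_pos (-(θ * x))]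

variable {E : Type*} [MeasurableSpace E] {ν : Measure E} {Z : E → ℝ}

theorem integrable_mul_exp_neg (hZ : Measurable Z) (hZ0 : ∀ᵐ x ∂ν, 0 ≤ Z x)
    (hInt : ∀ θ : ℝ, 0 < θ → Integrable (fun x => 1 - Real.exp (-(θ * Z x))) ν) {t : ℝ}
    (ht : t < 0) : Integrable (fun x => Z x * Real.exp (t * Z x)) ν := by
  refine ((hInt (-t) (by linarith)).div_const (-t)).mono' (by fun_prop) ?_
  filter_upwards [hZ0] with x hx
  rw [Real.norm_of_nonneg (mul_nonneg hx (Real.exp_pos _).le)]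
  have := Real.mul_exp_neg_le (x := Z x) (θ := -t) (by linarith)
  simpa using this

/-- The measure `z ν(dz)`. -/
noncomputable def sizeBiased (ν : Measure E) (Z : E → ℝ) : Measure E :=
  ν.withDensity fun x => ENNReal.ofReal (Z x)

theorem integral_sizeBiased (hZ : Measurable Z) (hZ0 : ∀ᵐ x ∂ν, 0 ≤ Z x) (f : E → ℝ) :
    ∫ x, f x ∂(sizeBiased ν Z) = ∫ x, Z x * f x ∂ν := by
  rw [sizeBiased, integral_withDensity_eq_integral_toReal_smul (by fun_prop) (by simp)]
  refine integral_congr_ae ?_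
  filter_upwards [hZ0] with x hx
  rw [ENNReal.toReal_ofReal hx, smul_eq_mul]

theorem integrable_sizeBiased_iff (hZ : Measurable Z) (hZ0 : ∀ᵐ x ∂ν, 0 ≤ Z x) {f : E → ℝ} :
    Integrable f (sizeBiased ν Z) ↔ Integrable (fun x => Z x * f x) ν := by
  rw [sizeBiased, integrable_withDensity_iff_integrable_smul' (by fun_prop) (by simp)]
  refine integrable_congr ?_
  filter_upwards [hZ0] with x hx
  rw [ENNReal.toReal_ofReal hx, smul_eq_mul]

/-- In the application ν has infinite mass and e^(tZ) is not ν-integrable. Weighting by Z yields a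
moment generating function that is finite, hence analytic, on t < 0. -/
theorem mem_interior_integrableExpSet_sizeBiased (hZ : Measurable Z) (hZ0 : ∀ᵐ x ∂ν, 0 ≤ Z x)
    (hInt : ∀ θ : ℝ, 0 < θ → Integrable (fun x => 1 - Real.exp (-(θ * Z x))) ν) {t : ℝ}
    (ht : t < 0) : t ∈ interior (integrableExpSet Z (sizeBiased ν Z)) :=
  interior_maximal (s := integrableExpSet Z (sizeBiased ν Z)) (t := Set.Iio 0)
    (fun _ hs => (integrable_sizeBiased_iff hZ hZ0).2 (integrable_mul_exp_neg hZ hZ0 hInt hs))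
    isOpen_Iio ht

theorem mem_interior_integrableExpSet_of_neg [IsFiniteMeasure ν] (hZ : Measurable Z)
    (hZ0 : ∀ᵐ x ∂ν, 0 ≤ Z x) {t : ℝ} (ht : t < 0) : t ∈ interior (integrableExpSet Z ν) := by
  refine interior_maximal (s := integrableExpSet Z ν) (t := Set.Iio 0) (fun s (hs : s < 0) => ?_)
    isOpen_Iio ht
  refine Integrable.of_bound (by fun_prop) 1 ?_
  filter_upwards [hZ0] with x hx
  rw [Real.norm_of_nonneg (Real.exp_pos _).le, Real.exp_le_one_iff]
  exact mul_nonpos_of_nonpos_of_nonneg hs.le hx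

/-- For s < t/2, a neighbourhood of t, the derivative of the integrand is dominated by Z e^((t/2)Z),
which is integrable because t/2 is still negative. -/
theorem hasDerivAt_integral_one_sub_exp (hZ : Measurable Z) (hZ0 : ∀ᵐ x ∂ν, 0 ≤ Z x)
    (hInt : ∀ θ : ℝ, 0 < θ → Integrable (fun x => 1 - Real.exp (-(θ * Z x))) ν) {t : ℝ}
    (ht : t < 0) :
    HasDerivAt (fun t => ∫ x, (1 - Real.exp (t * Z x)) ∂ν) (-mgf Z (sizeBiased ν Z) t) t := by
  have hball : Set.Iio (t / 2) ∈ nhds t := Iio_mem_nhds (by linarith)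
  have h := hasDerivAt_integral_of_dominated_loc_of_deriv_le (μ := ν) (x₀ := t)
    (F := fun t x => 1 - Real.exp (t * Z x)) (F' := fun t x => -(Z x * Real.exp (t * Z x)))
    (bound := fun x => Z x * Real.exp (t / 2 * Z x)) hball
    (Filter.Eventually.of_forall fun s => by fun_prop)
    (by simpa using hInt (-t) (by linarith)) (by fun_prop) ?_
    (integrable_mul_exp_neg hZ hZ0 hInt (by linarith))
    (Filter.Eventually.of_forall fun x s _ => ?_)
  · refine h.2.congr_deriv ?_
    rw [integral_neg, mgf, integral_sizeBiased hZ hZ0]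
  · filter_upwards [hZ0] with x hx s hs
    rw [norm_neg, Real.norm_of_nonneg (mul_nonneg hx (Real.exp_pos _).le)]
    exact mul_le_mul_of_nonneg_left (Real.exp_le_exp.2 (mul_le_mul_of_nonneg_right
      (le_of_lt hs) hx)) hx
  · have h1 : HasDerivAt (fun s : ℝ => s * Z x) (Z x) s := by
      simpa using (hasDerivAt_id s).mul_const (Z x)
    refine (h1.exp.const_sub 1).congr_deriv (by ring)

variable {F : Type*} [MeasurableSpace F] {g : Measure F} [IsProbabilityMeasure g] {Y : F → ℝ}
  {lam : ℝ}

/-- The moment recursion of an infinitely divisible law, with exponential tilting. -/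
theorem integral_pow_succ_mul_exp (hZ : Measurable Z) (hZ0 : ∀ᵐ x ∂ν, 0 ≤ Z x)
    (hInt : ∀ θ : ℝ, 0 < θ → Integrable (fun x => 1 - Real.exp (-(θ * Z x))) ν)
    (hY : Measurable Y) (hY0 : ∀ᵐ x ∂g, 0 ≤ Y x)
    (hlap : ∀ θ : ℝ, 0 < θ → ∫ x, Real.exp (-(θ * Y x)) ∂g =
      Real.exp (-(lam * ∫ x, (1 - Real.exp (-(θ * Z x))) ∂ν))) (n : ℕ) {t : ℝ} (ht : t < 0) :
    ∫ x, Y x ^ (n + 1) * Real.exp (t * Y x) ∂g =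
      ∑ i ∈ Finset.range (n + 1), (n.choose i : ℝ) *
        (lam * ∫ x, Z x ^ (i + 1) * Real.exp (t * Z x) ∂ν) *
        ∫ x, Y x ^ (n - i) * Real.exp (t * Y x) ∂g := by
  have hZint : ∀ {s : ℝ}, s < 0 → s ∈ interior (integrableExpSet Z (sizeBiased ν Z)) :=
    fun hs => mem_interior_integrableExpSet_sizeBiased hZ hZ0 hInt hs
  have hYint : ∀ {s : ℝ}, s < 0 → s ∈ interior (integrableExpSet Y g) :=
    fun hs => mem_interior_integrableExpSet_of_neg hY hY0 hs
  have hmgf : ∀ s : ℝ, s < 0 →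
      mgf Y g s = Real.exp (-(lam * ∫ x, (1 - Real.exp (s * Z x)) ∂ν)) := fun s hs => by
    simpa [mgf] using hlap (-s) (by linarith)
  -- The logarithmic derivative of the transform of Y is λ times the transform of the size-biased
  -- measure. Leibniz' rule for the n-th derivative of this product is the recursion.
  have hderiv : deriv (mgf Y g) =ᶠ[nhds t]
      fun s => (lam * mgf Z (sizeBiased ν Z) s) * mgf Y g s := by
    filter_upwards [Iio_mem_nhds ht] with s hs
    have hs' : s < 0 := hs
    have heq : mgf Y g =ᶠ[nhds s]
        fun s => Real.exp (-(lam * ∫ x, (1 - Real.exp (s * Z x)) ∂ν)) := by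
      filter_upwards [Iio_mem_nhds hs'] with s hs using hmgf s hs
    rw [heq.deriv_eq, hmgf s hs']
    refine ((((hasDerivAt_integral_one_sub_exp hZ hZ0 hInt hs').const_mul lam).neg).exp.congr_deriv
      ?_).deriv
    simp only [Pi.neg_apply]
    ring
  have hsmooth : ContDiffAt ℝ n (mgf Y g) t := (analyticAt_mgf (hYint ht)).contDiffAt
  have hsmooth' : ContDiffAt ℝ n (mgf Z (sizeBiased ν Z)) t :=
    (analyticAt_mgf (hZint ht)).contDiffAt
  rw [← iteratedDeriv_mgf (hYint ht), iteratedDeriv_succ', hderiv.iteratedDeriv_eq,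
    iteratedDeriv_fun_mul (contDiffAt_const.mul hsmooth') hsmooth]
  refine Finset.sum_congr rfl fun i _ => ?_
  rw [iteratedDeriv_const_mul_field, iteratedDeriv_mgf (hYint ht), iteratedDeriv_mgf (hZint ht),
    integral_sizeBiased hZ hZ0]
  congr 4
  ext x
  ring

/-- Monotone convergence: the tilt 1/(m+1) decreases to 0, and the limit may be infinite. -/
theorem lintegral_pow_mul_exp_tendsto (hZ : Measurable Z) (hZ0 : ∀ᵐ x ∂ν, 0 ≤ Z x) (i : ℕ) :
    Filter.Tendsto (fun m : ℕ => ∫⁻ x, ENNReal.ofReal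
        (Z x ^ i * Real.exp (-(1 / ((m : ℝ) + 1)) * Z x)) ∂ν) Filter.atTop
      (nhds (∫⁻ x, ENNReal.ofReal (Z x ^ i) ∂ν)) := by
  refine lintegral_tendsto_of_tendsto_of_monotone (fun m => by fun_prop) ?_ ?_
  · filter_upwards [hZ0] with x hx
    intro m m' hmm
    refine ENNReal.ofReal_le_ofReal (mul_le_mul_of_nonneg_left (Real.exp_le_exp.2
      (mul_le_mul_of_nonneg_right ?_ hx)) (pow_nonneg hx i))
    exact neg_le_neg (Nat.one_div_le_one_div hmm)
  · refine Filter.Eventually.of_forall fun x => ?_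
    refine ENNReal.tendsto_ofReal ?_
    have h1 : Filter.Tendsto (fun m : ℕ => -(1 / ((m : ℝ) + 1)) * Z x) Filter.atTop (nhds 0) := by
      simpa using (tendsto_one_div_add_atTop_nhds_zero_nat (𝕜 := ℝ)).neg.mul_const (Z x)
    simpa using ((Real.continuous_exp.tendsto 0).comp h1).const_mul (Z x ^ i)

/-- The moment recursion of a nonnegative infinitely divisible law: the moments may be infinite. -/
theorem lintegral_pow_succ (hlam : 0 ≤ lam) (hZ : Measurable Z) (hZ0 : ∀ᵐ x ∂ν, 0 ≤ Z x)
    (hInt : ∀ θ : ℝ, 0 < θ → Integrable (fun x => 1 - Real.exp (-(θ * Z x))) ν)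
    (hY : Measurable Y) (hY0 : ∀ᵐ x ∂g, 0 ≤ Y x)
    (hlap : ∀ θ : ℝ, 0 < θ → ∫ x, Real.exp (-(θ * Y x)) ∂g =
      Real.exp (-(lam * ∫ x, (1 - Real.exp (-(θ * Z x))) ∂ν)))
    (hZne : ∀ i : ℕ, ∫⁻ x, ENNReal.ofReal (Z x ^ (i + 1)) ∂ν ≠ 0)
    (hYne : ∀ i : ℕ, ∫⁻ x, ENNReal.ofReal (Y x ^ i) ∂g ≠ 0) (n : ℕ) :
    ∫⁻ x, ENNReal.ofReal (Y x ^ (n + 1)) ∂g =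
      ∑ i ∈ Finset.range (n + 1), (n.choose i : ℝ≥0∞) * (ENNReal.ofReal lam *
        ((∫⁻ x, ENNReal.ofReal (Z x ^ (i + 1)) ∂ν) *
        ∫⁻ x, ENNReal.ofReal (Y x ^ (n - i)) ∂g)) := by
  have hYi : ∀ (i : ℕ) {t : ℝ}, t < 0 → ENNReal.ofReal (∫ x, Y x ^ i * Real.exp (t * Y x) ∂g) =
      ∫⁻ x, ENNReal.ofReal (Y x ^ i * Real.exp (t * Y x)) ∂g := fun i t ht => by
    refine ofReal_integral_eq_lintegral_ofReal
      (integrable_pow_mul_exp_of_mem_interior_integrableExpSet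
        (mem_interior_integrableExpSet_of_neg hY hY0 ht) i) ?_
    filter_upwards [hY0] with x hx using mul_nonneg (pow_nonneg hx i) (Real.exp_pos _).le
  have hZi : ∀ (i : ℕ) {t : ℝ}, t < 0 →
      ENNReal.ofReal (∫ x, Z x ^ (i + 1) * Real.exp (t * Z x) ∂ν) =
      ∫⁻ x, ENNReal.ofReal (Z x ^ (i + 1) * Real.exp (t * Z x)) ∂ν := fun i t ht => by
    refine ofReal_integral_eq_lintegral_ofReal ?_ ?_
    · have := (integrable_sizeBiased_iff hZ hZ0).1
        (integrable_pow_mul_exp_of_mem_interior_integrableExpSet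
          (mem_interior_integrableExpSet_sizeBiased hZ hZ0 hInt ht) i)
      refine this.congr (Filter.Eventually.of_forall fun x => ?_)
      simp only
      ring
    · filter_upwards [hZ0] with x hx using mul_nonneg (pow_nonneg hx _) (Real.exp_pos _).le
  have hpos : ∀ m : ℕ, -(1 / ((m : ℝ) + 1)) < 0 := fun m => by
    rw [neg_lt_zero]; positivity
  have hnn : ∀ (i : ℕ) (t : ℝ), 0 ≤ ∫ x, Y x ^ i * Real.exp (t * Y x) ∂g := fun i t =>
    integral_nonneg_of_ae (by
      filter_upwards [hY0] with x hx using mul_nonneg (pow_nonneg hx i) (Real.exp_pos _).le)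
  have hnn' : ∀ (i : ℕ) (t : ℝ), 0 ≤ ∫ x, Z x ^ i * Real.exp (t * Z x) ∂ν := fun i t =>
    integral_nonneg_of_ae (by
      filter_upwards [hZ0] with x hx using mul_nonneg (pow_nonneg hx i) (Real.exp_pos _).le)
  have htilt : ∀ m : ℕ, ∫⁻ x, ENNReal.ofReal
      (Y x ^ (n + 1) * Real.exp (-(1 / ((m : ℝ) + 1)) * Y x)) ∂g =
      ∑ i ∈ Finset.range (n + 1), (n.choose i : ℝ≥0∞) * (ENNReal.ofReal lam *
        ((∫⁻ x, ENNReal.ofReal (Z x ^ (i + 1) * Real.exp (-(1 / ((m : ℝ) + 1)) * Z x)) ∂ν) *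
        ∫⁻ x, ENNReal.ofReal (Y x ^ (n - i) * Real.exp (-(1 / ((m : ℝ) + 1)) * Y x)) ∂g)) := by
    intro m
    rw [← hYi _ (hpos m), integral_pow_succ_mul_exp hZ hZ0 hInt hY hY0 hlap n (hpos m),
      ENNReal.ofReal_sum_of_nonneg fun i _ => mul_nonneg (mul_nonneg (Nat.cast_nonneg _)
        (mul_nonneg hlam (hnn' _ _))) (hnn _ _)]
    refine Finset.sum_congr rfl fun i _ => ?_
    rw [← hYi _ (hpos m), ← hZi _ (hpos m), ENNReal.ofReal_mul (mul_nonneg (Nat.cast_nonneg _)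
      (mul_nonneg hlam (hnn' _ _))), ENNReal.ofReal_mul (Nat.cast_nonneg _),
      ENNReal.ofReal_mul hlam, ENNReal.ofReal_natCast]
    ring
  -- Multiplication in [0, ∞] is discontinuous at 0 · ∞; the nonvanishing of all moments excludes
  -- this case.
  refine tendsto_nhds_unique (lintegral_pow_mul_exp_tendsto hY hY0 (n + 1)) ?_
  simp only [htilt]
  refine tendsto_finsetSum _ fun i _ => ?_
  refine ENNReal.Tendsto.const_mul (ENNReal.Tendsto.const_mul (ENNReal.Tendsto.mul
    (lintegral_pow_mul_exp_tendsto hZ hZ0 (i + 1)) (Or.inl (hZne _))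
    (lintegral_pow_mul_exp_tendsto hY hY0 (n - i)) (Or.inl (hYne _)))
      (Or.inr ENNReal.ofReal_ne_top))
    (Or.inr (ENNReal.natCast_ne_top _))

end MomentRecursion

/-! ### Bell polynomials: recursion and homogeneity -/

section Bell

/-- The vectors `(j_1, …, j_N)` with `∑ i j_i = n`; the entry `j_i` is stored at position
`i - 1`. -/
def weightIndices (N n : ℕ) : Finset (Fin N → ℕ) :=
  (Fintype.piFinset fun _ => Finset.range (n + 1)).filter fun j =>
    ∑ i : Fin N, ((i : ℕ) + 1) * j i = n

theorem mem_weightIndices {N n : ℕ} {j : Fin N → ℕ} :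
    j ∈ weightIndices N n ↔ ∑ i : Fin N, ((i : ℕ) + 1) * j i = n := by
  simp only [weightIndices, Finset.mem_filter, Fintype.mem_piFinset, Finset.mem_range,
    and_iff_right_iff_imp]
  intro h i
  have := Finset.single_le_sum (f := fun i : Fin N => ((i : ℕ) + 1) * j i)
    (fun _ _ => Nat.zero_le _) (Finset.mem_univ i)
  simp only [h] at this
  nlinarith

theorem mem_bellIndices {n k : ℕ} {j : Fin (n - k + 1) → ℕ} :
    j ∈ bellIndices n k ↔ ∑ i, j i = k ∧ ∑ i : Fin (n - k + 1), ((i : ℕ) + 1) * j i = n := by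
  have h : j ∈ bellIndices n k ↔ ∑ i, j i = k ∧ j ∈ weightIndices (n - k + 1) n := by
    simp only [bellIndices, weightIndices, Finset.mem_filter]
    tauto
  rw [h, mem_weightIndices]

/-- The summand of the Bell polynomials. -/
noncomputable def bellWeight (x : ℕ → ℝ) {N : ℕ} (j : Fin N → ℕ) : ℝ :=
  ∏ i : Fin N, 1 / ((j i).factorial : ℝ) *
    (x ((i : ℕ) + 1) / (((i : ℕ) + 1).factorial : ℝ)) ^ j i

/-- The difference of the two constraints is ∑ a j_a = n - k over the positions a, counted from 0,
so no position beyond n - k is occupied. -/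
theorem eq_zero_of_lt_add {N n k : ℕ} {j : Fin N → ℕ}
    (h : ∑ i : Fin N, ((i : ℕ) + 1) * j i = n) (h' : ∑ i, j i = k) {a : Fin N} (ha : n < k + a) :
    j a = 0 := by
  have h1 : ∑ i : Fin N, (i : ℕ) * j i + k = n := by
    rw [← h', ← Finset.sum_add_distrib, ← h]
    exact Finset.sum_congr rfl fun i _ => by ring
  have h2 := Finset.single_le_sum (f := fun i : Fin N => (i : ℕ) * j i)
    (fun _ _ => Nat.zero_le _) (Finset.mem_univ a)
  by_contra hne
  have h3 := Nat.le_mul_of_pos_right (a : ℕ) (Nat.pos_of_ne_zero hne)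
  omega

/-- Padding with zeros gives the index vectors of all k a common length N, so that the sums over k
can be merged. -/
theorem sum_bellIndices_eq (x : ℕ → ℝ) {n k N d : ℕ} (hk : k ≤ n) (hN : n - k + 1 + d = N) :
    ∑ j ∈ bellIndices n k, bellWeight x j =
      ∑ j ∈ weightIndices N n with ∑ i, j i = k, bellWeight x j := by
  subst hN
  refine Finset.sum_nbij' (fun j => Fin.append j (fun _ : Fin d => 0))
    (fun j => j ∘ Fin.castAdd d) ?_ ?_ ?_ ?_ ?_
  · intro j hj
    rw [mem_bellIndices] at hj
    rw [Finset.mem_filter, mem_weightIndices]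
    simpa [Fin.sum_univ_add] using hj.symm
  · intro j hj
    rw [Finset.mem_filter, mem_weightIndices] at hj
    rw [mem_bellIndices]
    have hz : ∀ a : Fin d, j (Fin.natAdd (n - k + 1) a) = 0 := fun a =>
      eq_zero_of_lt_add hj.1 hj.2 (by rw [Fin.val_natAdd]; omega)
    simpa [Fin.sum_univ_add, hz] using hj.symm
  · intro j _
    ext i
    simp
  · intro j hj
    rw [Finset.mem_filter, mem_weightIndices] at hj
    have hz : ∀ a : Fin d, j (Fin.natAdd (n - k + 1) a) = 0 := fun a =>
      eq_zero_of_lt_add hj.1 hj.2 (by rw [Fin.val_natAdd]; omega)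
    ext i
    refine Fin.addCases (fun i => ?_) (fun i => ?_) i
    · simp
    · simp [hz i]
  · intro j _
    simp [bellWeight, Fin.prod_univ_add]

/-- The complete Bell polynomial as a single sum. -/
theorem sum_bellPolynomial (x : ℕ → ℝ) {n : ℕ} (hn : 1 ≤ n) :
    ∑ k ∈ Finset.Icc 1 n, bellPolynomial n k x =
      n.factorial * ∑ j ∈ weightIndices n n, bellWeight x j := by
  have hmaps : ∀ j ∈ weightIndices n n, ∑ i, j i ∈ Finset.Icc 1 n := by
    intro j hj
    rw [mem_weightIndices] at hj
    rw [Finset.mem_Icc]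
    constructor
    · by_contra! hlt
      have h0 : ∀ i, j i = 0 := by
        have : ∑ i, j i = 0 := by omega
        simpa using this
      simp [h0] at hj
      omega
    · calc ∑ i, j i ≤ ∑ i : Fin n, ((i : ℕ) + 1) * j i :=
            Finset.sum_le_sum fun i _ => Nat.le_mul_of_pos_left _ (Nat.succ_pos _)
        _ = n := hj
  rw [← Finset.sum_fiberwise_of_maps_to hmaps, Finset.mul_sum]
  refine Finset.sum_congr rfl fun k hk => ?_
  rw [Finset.mem_Icc] at hk
  rw [← sum_bellIndices_eq x hk.2 (d := k - 1) (by omega)]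
  rfl

theorem bellWeight_update (x : ℕ → ℝ) {N : ℕ} (j : Fin N → ℕ) (i : Fin N) :
    ((j i + 1 : ℕ) : ℝ) * bellWeight x (Function.update j i (j i + 1)) =
      x ((i : ℕ) + 1) / (((i : ℕ) + 1).factorial : ℝ) * bellWeight x j := by
  simp only [bellWeight]
  rw [← Finset.mul_prod_erase _ _ (Finset.mem_univ i), ← Finset.mul_prod_erase _
    (fun i : Fin N => 1 / ((j i).factorial : ℝ) *
      (x ((i : ℕ) + 1) / (((i : ℕ) + 1).factorial : ℝ)) ^ j i) (Finset.mem_univ i)]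
  have herase : ∏ a ∈ Finset.univ.erase i, (1 / ((Function.update j i (j i + 1) a).factorial : ℝ) *
      (x ((a : ℕ) + 1) / (((a : ℕ) + 1).factorial : ℝ)) ^ Function.update j i (j i + 1) a) =
      ∏ a ∈ Finset.univ.erase i, (1 / ((j a).factorial : ℝ) *
      (x ((a : ℕ) + 1) / (((a : ℕ) + 1).factorial : ℝ)) ^ j a) :=
    Finset.prod_congr rfl fun a ha => by
      rw [Function.update_of_ne (Finset.ne_of_mem_erase ha)]
  rw [herase, Function.update_self, Nat.factorial_succ, pow_succ]
  have h1 : ((j i).factorial : ℝ) ≠ 0 := by exact_mod_cast (j i).factorial_ne_zero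
  have h2 : ((j i : ℝ) + 1) ≠ 0 := by positivity
  push_cast
  field_simp

theorem sum_update_weight {N : ℕ} (j : Fin N → ℕ) (i : Fin N) :
    ∑ a : Fin N, ((a : ℕ) + 1) * Function.update j i (j i + 1) a =
      ∑ a : Fin N, ((a : ℕ) + 1) * j a + (i + 1) := by
  rw [← Finset.add_sum_erase _ _ (Finset.mem_univ i), ← Finset.add_sum_erase _
    (fun a : Fin N => ((a : ℕ) + 1) * j a) (Finset.mem_univ i), Function.update_self,
    Finset.sum_congr rfl fun a ha => by
      rw [Function.update_of_ne (Finset.ne_of_mem_erase ha)]]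
  ring

/-- Terms with j_i = 0 drop out. From the others one part is removed: position i stands for a part
of size i + 1, so the weight falls from m + 1 to m - i, and for i > m no such part fits. -/
theorem sum_mul_bellWeight (x : ℕ → ℝ) {N m : ℕ} (i : Fin N) :
    ∑ j ∈ weightIndices N (m + 1), (j i : ℝ) * bellWeight x j =
      if (i : ℕ) ≤ m then x ((i : ℕ) + 1) / (((i : ℕ) + 1).factorial : ℝ) *
        ∑ j ∈ weightIndices N (m - i), bellWeight x j else 0 := by
  split_ifs with him
  · rw [Finset.mul_sum]
    symm
    refine Finset.sum_of_injOn (fun j => Function.update j i (j i + 1)) ?_ ?_ ?_ ?_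
    · intro j _ j' _ hjj
      ext a
      have := congrFun hjj a
      by_cases ha : a = i
      · subst ha; simpa using this
      · simpa [ha] using this
    · intro j hj
      rw [Finset.mem_coe, mem_weightIndices] at hj ⊢
      rw [sum_update_weight, hj]
      omega
    · intro j hj hnot
      have : j i = 0 := by
        by_contra hne
        refine hnot ⟨Function.update j i (j i - 1), ?_, ?_⟩
        · rw [mem_weightIndices] at hj
          rw [Finset.mem_coe, mem_weightIndices]
          have h := sum_update_weight (Function.update j i (j i - 1)) i
          simp only [Function.update_self, Function.update_idem,
            Nat.sub_add_cancel (Nat.one_le_iff_ne_zero.2 hne), Function.update_eq_self] at h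
          omega
        · simp [Nat.sub_add_cancel (Nat.one_le_iff_ne_zero.2 hne)]
      simp [this]
    · intro j _
      rw [← bellWeight_update, Function.update_self]
  · refine Finset.sum_eq_zero fun j hj => ?_
    rw [mem_weightIndices] at hj
    have h1 := Finset.single_le_sum (f := fun i : Fin N => ((i : ℕ) + 1) * j i)
      (fun _ _ => Nat.zero_le _) (Finset.mem_univ i)
    simp only [hj] at h1
    have : j i = 0 := by
      by_contra hne
      have := Nat.le_mul_of_pos_right ((i : ℕ) + 1) (Nat.pos_of_ne_zero hne)
      omega
    simp [this]

theorem weightIndices_zero (N : ℕ) : weightIndices N 0 = {0} := by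
  ext j
  rw [mem_weightIndices, Finset.mem_singleton]
  constructor
  · intro h
    ext i
    have := (Finset.sum_eq_zero_iff.1 h) i (Finset.mem_univ i)
    simpa using this
  · rintro rfl
    simp

/-- The recursion of the complete Bell polynomials. -/
theorem factorial_mul_sum_bellWeight_succ (x : ℕ → ℝ) {N m : ℕ} (hm : m + 1 ≤ N) :
    ((m + 1).factorial : ℝ) * ∑ j ∈ weightIndices N (m + 1), bellWeight x j =
      ∑ i ∈ Finset.range (m + 1), (m.choose i : ℝ) * x (i + 1) *
        (((m - i).factorial : ℝ) * ∑ j ∈ weightIndices N (m - i), bellWeight x j) := by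
  set V : ℕ → ℝ := fun m => ∑ j ∈ weightIndices N m, bellWeight x j with hV
  -- The factor m + 1 is written as the weight ∑ (i + 1) j_i of each index vector, which prepares
  -- the removal of one part.
  have h1 : ((m : ℝ) + 1) * V (m + 1) = ∑ i : Fin N, ((i : ℝ) + 1) *
      ∑ j ∈ weightIndices N (m + 1), (j i : ℝ) * bellWeight x j := by
    simp only [hV, Finset.mul_sum]
    rw [Finset.sum_comm]
    refine Finset.sum_congr rfl fun j hj => ?_
    rw [mem_weightIndices] at hj
    have : ((m : ℝ) + 1) = ∑ i : Fin N, ((i : ℝ) + 1) * (j i : ℝ) := by exact_mod_cast hj.symm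
    rw [this, Finset.sum_mul]
    exact Finset.sum_congr rfl fun i _ => by ring
  have h2 : ((m : ℝ) + 1) * V (m + 1) = ∑ i ∈ Finset.range (m + 1),
      ((i : ℝ) + 1) * (x (i + 1) / ((i + 1).factorial : ℝ) * V (m - i)) := by
    rw [h1]
    simp only [sum_mul_bellWeight]
    rw [Fin.sum_univ_eq_sum_range (fun i : ℕ => ((i : ℝ) + 1) *
      if i ≤ m then x (i + 1) / ((i + 1).factorial : ℝ) * V (m - i) else 0) N]
    rw [← Finset.sum_subset (Finset.range_mono hm) fun i _ hi => by
      rw [if_neg (by simpa [Nat.lt_succ_iff] using hi), mul_zero]]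
    exact Finset.sum_congr rfl fun i hi => by
      rw [if_pos (Nat.lt_succ_iff.1 (Finset.mem_range.1 hi))]
  rw [Nat.factorial_succ]
  push_cast
  rw [mul_right_comm, h2, Finset.sum_mul]
  refine Finset.sum_congr rfl fun i hi => ?_
  have him : i ≤ m := Nat.lt_succ_iff.1 (Finset.mem_range.1 hi)
  have hc : (m.choose i : ℝ) * i.factorial * (m - i).factorial = m.factorial := by
    exact_mod_cast Nat.choose_mul_factorial_mul_factorial him
  have hi0 : (i.factorial : ℝ) ≠ 0 := by exact_mod_cast i.factorial_ne_zero
  have hi1 : ((i : ℝ) + 1) ≠ 0 := by positivity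
  rw [← hc, Nat.factorial_succ]
  push_cast
  simp only [hV]
  field_simp

/-- The solution of the moment recursion in terms of the Bell polynomials. -/
theorem eq_sum_bellPolynomial_of_recursion (y M : ℕ → ℝ) {n : ℕ} (hn : 1 ≤ n) (h0 : M 0 = 1)
    (hM : ∀ m < n, M (m + 1) =
      ∑ i ∈ Finset.range (m + 1), (m.choose i : ℝ) * y (i + 1) * M (m - i)) :
    M n = ∑ k ∈ Finset.Icc 1 n, bellPolynomial n k y := by
  rw [sum_bellPolynomial y hn]
  have key : ∀ m ≤ n, M m = m.factorial * ∑ j ∈ weightIndices n m, bellWeight y j := by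
    intro m
    induction m using Nat.strong_induction_on with
    | _ m ih =>
      intro hm
      rcases m with _ | m
      · simp [h0, weightIndices_zero, bellWeight]
      · rw [hM m hm, factorial_mul_sum_bellWeight_succ y hm]
        refine Finset.sum_congr rfl fun i _ => ?_
        rw [ih (m - i) (by omega) (by omega)]
  exact key n le_rfl

/-- The constraints ∑ j_i = k and ∑ i j_i = n make every monomial scale with b^k and c^n. -/
theorem bellPolynomial_scale (x : ℕ → ℝ) (b c : ℝ) (n k : ℕ) :
    bellPolynomial n k (fun i => b * c ^ i * x i) = b ^ k * c ^ n * bellPolynomial n k x := by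
  simp only [bellPolynomial]
  rw [mul_left_comm]
  congr 1
  rw [Finset.mul_sum]
  refine Finset.sum_congr rfl fun j hj => ?_
  rw [mem_bellIndices] at hj
  have hb : b ^ k = ∏ i, b ^ j i := by rw [Finset.prod_pow_eq_pow_sum, hj.1]
  have hc : c ^ n = ∏ i : Fin (n - k + 1), c ^ (((i : ℕ) + 1) * j i) := by
    rw [Finset.prod_pow_eq_pow_sum, hj.2]
  rw [hb, hc, ← Finset.prod_mul_distrib, ← Finset.prod_mul_distrib]
  refine Finset.prod_congr rfl fun i _ => ?_
  rw [pow_mul, mul_div_assoc, mul_pow, mul_pow]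
  ring

end Bell

/-! ### Moments of the outlet flow -/

section OutletMoments

variable {Γ : Type*} [Fintype Γ] [DecidableEq Γ] {W : Watershed Γ} {Ω : Type*} [MeasurableSpace Ω]
  {μ : Measure Ω} {lam : ℝ} {T P : ℕ → Ω → ℝ}
  {X : FlowState Γ → ℝ → Ω → FlowState Γ} {g : Measure (FlowState Γ)}

/-- The response `φ(s) p` is nonnegative for almost all times `s > 0` and depths `p`. -/
theorem IsUniformRainfall.ae_response_nonneg (h : IsUniformRainfall μ lam T P)
    (W : Watershed Γ) :
    ∀ᵐ q : ℝ × ℝ ∂((volume.restrict (Set.Ioi 0)).prod (μ.map (P 1))),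
      0 ≤ W.impulse q.1 ∧ 0 < q.2 := by
  filter_upwards [Measure.quasiMeasurePreserving_fst.ae (ae_restrict_mem measurableSet_Ioi),
    Measure.quasiMeasurePreserving_snd.ae h.ae_depth_pos] with q h1 h2
  exact ⟨W.impulse_nonneg (le_of_lt h1), h2⟩

theorem Watershed.lintegral_impulse_pow (W : Watershed Γ) {i : ℕ} (hi : 1 ≤ i) :
    ∫⁻ s in Set.Ioi (0 : ℝ), ENNReal.ofReal (W.impulse s ^ i) =
      ENNReal.ofReal (∫ s in Set.Ioi (0 : ℝ), W.impulse s ^ i) :=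
  (ofReal_integral_eq_lintegral_ofReal (W.integrableOn_impulse_pow hi)
    ((ae_restrict_mem measurableSet_Ioi).mono fun _ hs =>
      pow_nonneg (W.impulse_nonneg (le_of_lt hs)) i)).symm

theorem IsInvariantDistribution.ae_outlet_pos (hg : IsInvariantDistribution μ X g)
    (W : Watershed Γ) : ∀ᵐ x ∂g, 0 < x (Sum.inl W.root) :=
  hg.ae_mem.mono fun _ hx => hx _

variable [IsProbabilityMeasure μ]

theorem IsUniformRainfall.lintegral_response_pow (h : IsUniformRainfall μ lam T P)
    (W : Watershed Γ) {i : ℕ} (hi : 1 ≤ i) :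
    ∫⁻ q : ℝ × ℝ, ENNReal.ofReal ((W.impulse q.1 * q.2) ^ i)
        ∂((volume.restrict (Set.Ioi 0)).prod (μ.map (P 1))) =
      ENNReal.ofReal (∫ s in Set.Ioi (0 : ℝ), W.impulse s ^ i) *
        ∫⁻ ω, ENNReal.ofReal (P 1 ω ^ i) ∂μ := by
  have hprob := h.isProbabilityMeasure_depth
  have hm := W.continuous_impulse.measurable
  rw [← lintegral_map (f := fun p : ℝ => ENNReal.ofReal (p ^ i)) (by fun_prop)
    (h.measurable_depth 1 le_rfl), ← W.lintegral_impulse_pow hi,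
    ← lintegral_prod_mul (by fun_prop) (by fun_prop)]
  refine lintegral_congr_ae ?_
  filter_upwards [h.ae_response_nonneg W] with q hq
  rw [mul_pow, ENNReal.ofReal_mul (pow_nonneg hq.1 i)]

theorem lintegral_ofReal_pow_ne_zero {E : Type*} [MeasurableSpace E] {ν : Measure E} [NeZero ν]
    {Z : E → ℝ} (hZ : Measurable Z) (hpos : ∀ᵐ x ∂ν, 0 < Z x) (i : ℕ) :
    ∫⁻ x, ENNReal.ofReal (Z x ^ i) ∂ν ≠ 0 := by
  rw [Ne, lintegral_eq_zero_iff (by fun_prop)]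
  intro h0
  have hfalse : ∀ᵐ _ ∂ν, False := by
    filter_upwards [h0, hpos] with x hx hx'
    have h1 : ENNReal.ofReal (Z x ^ i) = 0 := hx
    rw [ENNReal.ofReal_eq_zero] at h1
    exact absurd (pow_pos hx' i) (not_lt.2 h1)
  exact NeZero.ne ν (ae_eq_bot.1 (Filter.eventually_false_iff_eq_bot.1 hfalse))

/-- The moment recursion of the stationary streamflow at the outlet. -/
theorem IsInvariantDistribution.lintegral_outlet_pow_succ (hg : IsInvariantDistribution μ X g)
    (hX : IsFlowProcess μ W T P X) (h : IsUniformRainfall μ lam T P) (hlam : 0 < lam) (n : ℕ) :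
    ∫⁻ x, ENNReal.ofReal (x (Sum.inl W.root) ^ (n + 1)) ∂g =
      ∑ i ∈ Finset.range (n + 1), (n.choose i : ℝ≥0∞) * (ENNReal.ofReal lam *
        (ENNReal.ofReal (∫ s in Set.Ioi (0 : ℝ), W.impulse s ^ (i + 1)) *
          (∫⁻ ω, ENNReal.ofReal (P 1 ω ^ (i + 1)) ∂μ) *
        ∫⁻ x, ENNReal.ofReal (x (Sum.inl W.root) ^ (n - i)) ∂g)) := by
  have := hg.isProbabilityMeasure
  have hm := W.continuous_impulse.measurable
  have hlap : ∀ θ : ℝ, 0 < θ → _ := fun θ hθ => hg.integral_exp_neg_eq_prod hX h hlam hθ.le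
  have hrec := lintegral_pow_succ (g := g) (Y := fun x => x (Sum.inl W.root))
    (ν := (volume.restrict (Set.Ioi 0)).prod (μ.map (P 1))) (Z := fun q => W.impulse q.1 * q.2)
    hlam.le (by fun_prop)
    ((h.ae_response_nonneg W).mono fun q hq => mul_nonneg hq.1 hq.2.le)
    (fun θ hθ => (hlap θ hθ).1) (by fun_prop) ((hg.ae_outlet_pos W).mono fun _ hx => hx.le)
    (fun θ hθ => (hlap θ hθ).2) (fun i => ?_)
    (lintegral_ofReal_pow_ne_zero (by fun_prop) (hg.ae_outlet_pos W)) n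
  · simpa only [h.lintegral_response_pow W (Nat.le_add_left 1 _)] using hrec
  · rw [h.lintegral_response_pow W (Nat.le_add_left 1 i)]
    refine mul_ne_zero ?_ (lintegral_ofReal_pow_ne_zero (h.measurable_depth 1 le_rfl)
      (h.depth_pos 1 le_rfl) _)
    rw [Ne, ENNReal.ofReal_eq_zero, not_le]
    exact W.integral_impulse_pow_pos (Nat.le_add_left 1 i)

theorem lintegral_ofReal_pow_ne_top_iff {E : Type*} [MeasurableSpace E] {ν : Measure E}
    {Z : E → ℝ} (hZ : Measurable Z) (hpos : ∀ᵐ x ∂ν, 0 < Z x) (i : ℕ) :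
    ∫⁻ x, ENNReal.ofReal (Z x ^ i) ∂ν ≠ ⊤ ↔ Integrable (fun x => Z x ^ i) ν :=
  lintegral_ofReal_ne_top_iff_integrable (by fun_prop)
    (hpos.mono fun _ hx => pow_nonneg hx.le i)

theorem toReal_lintegral_ofReal_pow {E : Type*} [MeasurableSpace E] {ν : Measure E}
    {Z : E → ℝ} (hZ : Measurable Z) (hpos : ∀ᵐ x ∂ν, 0 < Z x) (i : ℕ) :
    (∫⁻ x, ENNReal.ofReal (Z x ^ i) ∂ν).toReal = ∫ x, Z x ^ i ∂ν :=
  (integral_eq_lintegral_of_nonneg_ae (hpos.mono fun _ hx => pow_nonneg hx.le i)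
    (by fun_prop)).symm

theorem integrable_pow_of_le {E : Type*} [MeasurableSpace E] {ν : Measure E} [IsFiniteMeasure ν]
    {Z : E → ℝ} (hZ : Measurable Z) (hpos : ∀ᵐ x ∂ν, 0 < Z x) {i n : ℕ} (hi : i ≤ n)
    (hn : Integrable (fun x => Z x ^ n) ν) : Integrable (fun x => Z x ^ i) ν := by
  refine ((integrable_const (1 : ℝ)).add hn).mono' (by fun_prop) ?_
  filter_upwards [hpos] with x hx
  rw [Real.norm_of_nonneg (pow_nonneg hx.le i)]
  simp only [Pi.add_apply]
  rcases le_total (Z x) 1 with h1 | h1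
  · have := pow_le_one₀ hx.le h1 (n := i)
    have := pow_pos hx n
    linarith
  · have := pow_le_pow_right₀ h1 hi
    linarith

/-- The recursion involves only lower flow moments and depth moments of order at most n, so
finiteness propagates by strong induction. -/
theorem IsInvariantDistribution.lintegral_outlet_pow_ne_top (hg : IsInvariantDistribution μ X g)
    (hX : IsFlowProcess μ W T P X) (h : IsUniformRainfall μ lam T P) (hlam : 0 < lam) {n : ℕ}
    (hP : Integrable (fun ω => P 1 ω ^ n) μ) {m : ℕ} (hm : m ≤ n) :
    ∫⁻ x, ENNReal.ofReal (x (Sum.inl W.root) ^ m) ∂g ≠ ⊤ := by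
  have := hg.isProbabilityMeasure
  have hP1 := h.measurable_depth 1 le_rfl
  induction m using Nat.strong_induction_on with
  | _ m ih =>
    rcases m with _ | m
    · simp
    · rw [hg.lintegral_outlet_pow_succ hX h hlam]
      refine ENNReal.sum_ne_top.2 fun i hi => ?_
      rw [Finset.mem_range] at hi
      have hPi := (lintegral_ofReal_pow_ne_top_iff hP1 (h.depth_pos 1 le_rfl) (i + 1)).2
        (integrable_pow_of_le hP1 (h.depth_pos 1 le_rfl) (by omega) hP)
      exact ENNReal.mul_ne_top (ENNReal.natCast_ne_top _) (ENNReal.mul_ne_top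
        ENNReal.ofReal_ne_top (ENNReal.mul_ne_top (ENNReal.mul_ne_top ENNReal.ofReal_ne_top hPi)
          (ih (m - i) (by omega) (by omega))))

/-- A finite flow moment of order m + 1 bounds each summand of the recursion. The summand i = m
contains the flow moment of order 0, which is 1, and is thus a positive multiple of the depth moment
of order m + 1. -/
theorem IsInvariantDistribution.integrable_outlet_pow_iff (hg : IsInvariantDistribution μ X g)
    (hX : IsFlowProcess μ W T P X) (h : IsUniformRainfall μ lam T P) (hlam : 0 < lam) {n : ℕ}
    (hn : 1 ≤ n) :
    Integrable (fun x : FlowState Γ => x (Sum.inl W.root) ^ n) g ↔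
      Integrable (fun ω => P 1 ω ^ n) μ := by
  have := hg.isProbabilityMeasure
  have hpos := hg.ae_outlet_pos W
  rw [← lintegral_ofReal_pow_ne_top_iff (by fun_prop) hpos]
  refine ⟨fun hfin => ?_, fun hP => hg.lintegral_outlet_pow_ne_top hX h hlam hP le_rfl⟩
  obtain ⟨m, rfl⟩ : ∃ m, n = m + 1 := ⟨n - 1, by omega⟩
  rw [hg.lintegral_outlet_pow_succ hX h hlam, ENNReal.sum_ne_top] at hfin
  have hlast := hfin m (Finset.self_mem_range_succ m)
  rw [← lintegral_ofReal_pow_ne_top_iff (h.measurable_depth 1 le_rfl) (h.depth_pos 1 le_rfl)]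
  intro htop
  have h1 : ENNReal.ofReal lam ≠ 0 := by simpa using hlam
  have h2 : ENNReal.ofReal (∫ s in Set.Ioi (0 : ℝ), W.impulse s ^ (m + 1)) ≠ 0 := by
    simpa using W.integral_impulse_pow_pos hn
  rw [htop, ENNReal.mul_top h2] at hlast
  simp [ENNReal.mul_top h1] at hlast

/-- The moments of the stationary streamflow at the outlet. -/
theorem IsInvariantDistribution.integral_outlet_pow (hg : IsInvariantDistribution μ X g)
    (hX : IsFlowProcess μ W T P X) (h : IsUniformRainfall μ lam T P) (hlam : 0 < lam) {n : ℕ}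
    (hn : 1 ≤ n) (hP : Integrable (fun ω => P 1 ω ^ n) μ) :
    ∫ x : FlowState Γ, x (Sum.inl W.root) ^ n ∂g =
      ∑ k ∈ Finset.Icc 1 n, bellPolynomial n k fun i =>
        lam * (∫ s in Set.Ioi (0 : ℝ), W.impulse s ^ i) * ∫ ω, P 1 ω ^ i ∂μ := by
  have := hg.isProbabilityMeasure
  have hpos := hg.ae_outlet_pos W
  have hP1 := h.measurable_depth 1 le_rfl
  have hPpos := h.depth_pos 1 le_rfl
  refine eq_sum_bellPolynomial_of_recursion _
    (fun m => ∫ x : FlowState Γ, x (Sum.inl W.root) ^ m ∂g) hn (by simp) fun m hm => ?_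
  have hterm : ∀ i ∈ Finset.range (m + 1), (m.choose i : ℝ≥0∞) * (ENNReal.ofReal lam *
        (ENNReal.ofReal (∫ s in Set.Ioi (0 : ℝ), W.impulse s ^ (i + 1)) *
          (∫⁻ ω, ENNReal.ofReal (P 1 ω ^ (i + 1)) ∂μ) *
        ∫⁻ x, ENNReal.ofReal (x (Sum.inl W.root) ^ (m - i)) ∂g)) ≠ ⊤ := by
    have hfin := hg.lintegral_outlet_pow_ne_top hX h hlam hP (m := m + 1) hm
    rwa [hg.lintegral_outlet_pow_succ hX h hlam, ENNReal.sum_ne_top] at hfin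
  rw [← toReal_lintegral_ofReal_pow (by fun_prop) hpos, hg.lintegral_outlet_pow_succ hX h hlam,
    ENNReal.toReal_sum hterm]
  refine Finset.sum_congr rfl fun i _ => ?_
  simp only [ENNReal.toReal_mul, ENNReal.toReal_natCast, ENNReal.toReal_ofReal hlam.le,
    ENNReal.toReal_ofReal (W.integral_impulse_pow_pos (Nat.le_add_left 1 i)).le,
    toReal_lintegral_ofReal_pow hP1 hPpos,
    toReal_lintegral_ofReal_pow (measurable_pi_apply (Sum.inl W.root)) hpos]
  ring

end OutletMoments

theorem proposition2 {Γ : Type*} [Fintype Γ] [DecidableEq Γ] (W : Watershed Γ)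
    {Ω : Type*} [MeasurableSpace Ω] (μ : Measure Ω) [IsProbabilityMeasure μ]
    (lam : ℝ) (hlam : 0 < lam) (T P : ℕ → Ω → ℝ) (hrain : IsUniformRainfall μ lam T P)
    (X : FlowState Γ → ℝ → Ω → FlowState Γ) (hX : IsFlowProcess μ W T P X)
    (g : Measure (FlowState Γ)) (hg : IsInvariantDistribution μ X g)
    (n : ℕ) (hn : 1 ≤ n) :
    (∀ α : ℝ, 0 < α → IntegrableOn (W.geoIntegrand α) (Set.Ioo 0 1)) ∧
    (Integrable (fun x : FlowState Γ => x (Sum.inl W.root) ^ n) g ↔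
      Integrable (fun ω => P 1 ω ^ n) μ) ∧
    (Integrable (fun ω => P 1 ω ^ n) μ →
      ∫ x : FlowState Γ, x (Sum.inl W.root) ^ n ∂g =
        (W.totalArea * W.K W.root) ^ n *
          ∑ k ∈ Finset.Icc 1 n, (lam / W.H W.root) ^ k *
            bellPolynomial n k (fun i => (∫ ω, P 1 ω ^ i ∂μ) * W.geoCoeff i)) := by
  refine ⟨fun α hα => W.integrableOn_geoIntegrand hα,
    hg.integrable_outlet_pow_iff hX hrain hlam hn, fun hP => ?_⟩
  -- By `Watershed.geoCoeff_natCast`, λ ∫ φ^i = (λ / H_r) (a K_r)^i c_i; `bellPolynomial_scale` then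
  -- extracts the constants.
  have hscale : (fun i => lam * (∫ s in Set.Ioi (0 : ℝ), W.impulse s ^ i) * ∫ ω, P 1 ω ^ i ∂μ) =
      fun i : ℕ => lam / W.H W.root * (W.totalArea * W.K W.root) ^ i *
        ((∫ ω, P 1 ω ^ i ∂μ) * W.geoCoeff i) := by
    ext i
    have hH := (W.H_pos W.root).ne'
    have hc : (W.totalArea * W.K W.root) ^ i ≠ 0 :=
      (pow_pos (mul_pos W.totalArea_pos (W.K_pos W.root)) i).ne'
    rw [W.geoCoeff_natCast i]
    generalize (W.totalArea * W.K W.root) ^ i = c at hc ⊢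
    field_simp
  rw [hg.integral_outlet_pow hX hrain hlam hn hP, hscale, Finset.mul_sum]
  refine Finset.sum_congr rfl fun k _ => ?_
  rw [bellPolynomial_scale]
  ring
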